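/- Let $n\ge1$ and let $d_1,\dots,d_n\ge 0$ be integers such that $N:=\sum_{i=1}^n d_i$ is even and positive. Take a set of $d_i$ half-edges at each vertex $i\in\{1,\dots,n\}$ and choose a uniformly random partition of the set of all $N$ half-edges into pairs; the pairs are the edges of a random multigraph on $\{1,\dots,n\}$ (the configuration model). Let $X_i$ be the number of loops at $i$, let $X_{ij}$ be the number of edges between $i$ and $j$, and let $$Z=\sum_{i=1}^n X_i+\sum_{1\le i<j\le n}\binom{X_{ij}}2 ,$$ the number of loops plus the number of pairs of parallel edges. Let $\hat X_i$ ($1\le i\le n$) and $\hat X_{ij}$ ($1\le i<j\le n$) be independent Poisson random variables with means $$\lambda_i=\frac{d_i(d_i-1)}{2N}\qquad\text{and}\qquad \lambda_{ij}=\frac{\sqrt{d_i(d_i-1)d_j(d_j-1)}}{N},$$ respectively, and let $$\hat Z=\sum_{i=1}^n\hat X_i+\sum_{1\le i<j\le n}\binom{\hat X_{ij}}2 .$$ Lemma 1.3. For every real $C$ and every integer $m\ge1$ there is a constant $C'=C'(C,m)$ such that, for all $n$ and $d_1,\dots,d_n$ as above with $\sum_{i=1}^n d_i^2\le CN$, the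 moment $\mathbb E\hat Z^m$ is finite, $$\bigl|\mathbb E Z^m-\mathbb E\hat Z^m\bigr|\le C'N^{-1/2},$$ and moreover $$\bigl|\mathbb E Z^m-\mathbb E\hat Z^m\bigr|\le C'\,\frac{\max_{1\le i\le n} d_i}{N}.$$ -/

import Mathlib

open MeasureTheory ProbabilityTheory
open scoped NNReal

namespace ConfigModel

variable {n : ℕ}

/-- The total number of half-edges, `N = ∑ d_i`. -/
def total (d : Fin n → ℕ) : ℕ := ∑ i, d i

/-- The set of half-edges: `d i` half-edges at each vertex `i`. -/
abbrev HalfEdge (d : Fin n → ℕ) : Type := Σ i : Fin n, Fin (d i)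

/-- A partition of the set of all half-edges into pairs, encoded by the map that sends each
half-edge to its partner (a fixed-point-free involution). -/
abbrev Pairing (d : Fin n → ℕ) : Type :=
  {σ : Equiv.Perm (HalfEdge d) // ∀ a, σ a ≠ a ∧ σ (σ a) = a}

/-- The pairs of half-edges that form the pairing; these are the edges of the multigraph. -/
def Pairing.edges {d : Fin n → ℕ} (σ : Pairing d) : Finset (Sym2 (HalfEdge d)) :=
  Finset.univ.image fun a => s(a, σ.1 a)

/-- The number of edges of the multigraph with end-vertices `i` and `j`; when `i = j`, this is
the number of loops at `i`. -/
def Pairing.mult {d : Fin n → ℕ} (σ : Pairing d) (i j : Fin n) : ℕ :=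
  (σ.edges.filter fun e => e.map Sigma.fst = s(i, j)).card

/-- The index set of the counts: the vertices `i` (for loops) and the pairs `i < j`. -/
abbrev Site (n : ℕ) : Type := Fin n ⊕ {p : Fin n × Fin n // p.1 < p.2}

/-- Given counts `x_i` and `x_{ij}` (`i < j`), the number
`∑ i, x_i + ∑_{i < j} (x_{ij} choose 2)`. -/
def loopsAndParallel (x : Site n → ℕ) : ℕ :=
  ∑ i, x (Sum.inl i) + ∑ p, (x (Sum.inr p)).choose 2

/-- The counts `X_i` (loops at `i`) and `X_{ij}` (edges between `i` and `j`) of the multigraph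
obtained from a pairing. -/
def Pairing.counts {d : Fin n → ℕ} (σ : Pairing d) : Site n → ℕ :=
  Sum.elim (fun i => σ.mult i i) (fun p => σ.mult p.1.1 p.1.2)

/-- `Z`, the number of loops plus the number of pairs of parallel edges. -/
def Pairing.Z {d : Fin n → ℕ} (σ : Pairing d) : ℕ := loopsAndParallel σ.counts

/-- `E Z ^ m`, the pairing being uniformly distributed over all pairings. -/
noncomputable def momentZ (d : Fin n → ℕ) (m : ℕ) : ℝ :=
  (∑ σ : Pairing d, (σ.Z : ℝ) ^ m) / Fintype.card (Pairing d)

/-- The Poisson parameters `λ_i = (d_i choose 2) / N` and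
`λ_{ij} = √(d_i (d_i - 1) d_j (d_j - 1)) / N`. -/
noncomputable def rate (d : Fin n → ℕ) : Site n → ℝ≥0 :=
  Sum.elim (fun i => ((d i).choose 2 : ℝ≥0) / total d)
    (fun p => NNReal.sqrt
      ((d p.1.1 * (d p.1.1 - 1) * (d p.1.2 * (d p.1.2 - 1)) : ℕ) : ℝ≥0) / total d)

/-- The joint law of the independent Poisson variables with the parameters `rate d`. -/
noncomputable def poissonLaw (d : Fin n → ℕ) : Measure (Site n → ℕ) :=
  Measure.pi fun s => poissonMeasure (rate d s)

end ConfigModel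

namespace ConfigModel

/-! The method is comparison of joint factorial moments. Let `k s` edges be prescribed at each site
`s`, let `t = ∑ s, k s`, and let `Δ` be the maximal degree. In the configuration model an ordered
choice of such edges is a choice of disjoint pairs of half-edges. Up to the factor `∏ s, sym s ^ k
s`, the factorial moment is therefore the product of the falling factorials of `d i` of length `deg
k i`, divided by `(N - 1)(N - 3) ⋯ (N - 2t + 1)` (`sum_fallingProd_counts`). Up to the same factor,
the Poisson moment has powers of `√(d i (d i - 1))` instead of falling factorials, and `N ^ t` below
(`prod_rate_pow`).

Changing the denominator costs a relative error `O(1/N)`. In the numerator, degree two is matched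
exactly. If all `v` non-isolated vertices of `k` have degree at least two, both moments are at most
`weight d k * (Δ²/N)^(t - v)` up to a constant, and `Δ²/N ≤ C`. For `t = v` all degrees are two and
the numerators agree; for `t > v` the difference gains a factor `1/Δ`, and one factor `Δ²/N` turns
into `Δ/N`. Hence the error is `O(Δ/N) * weight d k` (`abs_fallingProd_moment_sub_le`).

Degree one would spoil this, but expanding `Z ^ m` in falling products never creates it: a loop adds
two to a degree, and a pair of parallel edges adds either two new edges, or a single one next to an
edge already present, or none. The same recursion holds in both models, hence for the difference
(`momentDiff_succ`). The weights have bounded sum because `∑ d i ^ 2 / N ≤ C` (`abs_momentDiff_le`).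
Finally `Δ² ≤ C N` turns `Δ/N` into `√C N^(-1/2)`. -/

/-! ### Falling factorials with a step -/

/-- The falling factorial of length `k` with step `c`, i.e. `y (y - c) ⋯ (y - (k - 1) c)`. -/
noncomputable def stepFactorial (c y : ℝ) (k : ℕ) : ℝ := ∏ r ∈ Finset.range k, (y - c * r)

@[simp] lemma stepFactorial_zero (c y : ℝ) : stepFactorial c y 0 = 1 := by simp [stepFactorial]

lemma stepFactorial_succ (c y : ℝ) (k : ℕ) :
    stepFactorial c y (k + 1) = y * stepFactorial c (y - c) k := by
  unfold stepFactorial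
  rw [Finset.prod_range_succ', mul_comm]
  congr 1
  · simp
  · refine Finset.prod_congr rfl fun r _ => ?_
    push_cast
    ring

lemma stepFactorial_succ_right (c y : ℝ) (k : ℕ) :
    stepFactorial c y (k + 1) = stepFactorial c y k * (y - c * k) := by
  unfold stepFactorial
  rw [Finset.prod_range_succ]

lemma stepFactorial_mul (c y : ℝ) (k : ℕ) :
    stepFactorial c (c * y) k = c ^ k * stepFactorial 1 y k := by
  unfold stepFactorial
  rw [← Finset.card_range k, ← Finset.prod_const, Finset.card_range, ← Finset.prod_mul_distrib]
  refine Finset.prod_congr rfl fun r _ => ?_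
  ring

lemma stepFactorial_natCast (x k : ℕ) : stepFactorial 1 (x : ℝ) k = (x.descFactorial k : ℝ) := by
  induction k with
  | zero => simp
  | succ k ih =>
    rw [stepFactorial_succ_right, ih, Nat.descFactorial_succ]
    rcases le_total k x with h | h
    · push_cast [Nat.cast_sub h]
      ring
    · rcases h.eq_or_lt with rfl | h
      · simp
      · simp [Nat.descFactorial_of_lt h]

section Products

variable {ι : Type*} [Fintype ι] [DecidableEq ι]

lemma prod_stepFactorial_add_single (c y : ι → ℝ) (k : ι → ℕ) (s : ι) :
    ∏ i, stepFactorial (c i) (y i) ((k + Pi.single s 1 : ι → ℕ) i) =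
      y s * ∏ i, stepFactorial (c i) ((y - Pi.single s (c s) : ι → ℝ) i) (k i) := by
  rw [← Finset.mul_prod_erase _ _ (Finset.mem_univ s),
    ← Finset.mul_prod_erase Finset.univ (fun i => stepFactorial (c i) _ (k i))
      (Finset.mem_univ s), ← mul_assoc]
  congr 1
  · simp [stepFactorial_succ]
  · refine Finset.prod_congr rfl fun i hi => ?_
    have : i ≠ s := Finset.ne_of_mem_erase hi
    simp [Pi.single_eq_of_ne this]

lemma prod_stepFactorial_add_single_right (c y : ι → ℝ) (k : ι → ℕ) (s : ι) :
    ∏ i, stepFactorial (c i) (y i) ((k + Pi.single s 1 : ι → ℕ) i) =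
      (∏ i, stepFactorial (c i) (y i) (k i)) * (y s - c s * k s) := by
  rw [← Finset.mul_prod_erase _ _ (Finset.mem_univ s),
    ← Finset.mul_prod_erase Finset.univ (fun i => stepFactorial (c i) _ (k i))
      (Finset.mem_univ s), mul_right_comm]
  congr 1
  · simp [stepFactorial_succ_right]
  · refine Finset.prod_congr rfl fun i hi => ?_
    have : i ≠ s := Finset.ne_of_mem_erase hi
    simp [Pi.single_eq_of_ne this]

end Products

/-! ### Sites and degrees -/

variable {n : ℕ}

/-- The two end-vertices of a site. -/
def ends : Site n → Fin n × Fin n := Sum.elim (fun i => (i, i)) (fun p => p.1)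

/-- The number of orientations of an edge at a site that agree with the order of its ends. -/
def sym : Site n → ℝ := Sum.elim (fun _ => 2) (fun _ => 1)

/-- The degree of the vertex `i` in the multigraph with `k s` edges at each site `s`. -/
def deg (k : Site n → ℕ) (i : Fin n) : ℕ :=
  ∑ s, k s * ((if (ends s).1 = i then 1 else 0) + if (ends s).2 = i then 1 else 0)

lemma deg_add (k l : Site n → ℕ) : deg (k + l) = deg k + deg l := by
  ext i
  simp [deg, add_mul, Finset.sum_add_distrib]

lemma deg_single (s : Site n) :
    deg (Pi.single s 1) = Pi.single (ends s).1 1 + Pi.single (ends s).2 1 := by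
  ext i
  simp only [deg, Pi.single_apply, ite_mul, zero_mul, one_mul, Finset.sum_ite_eq',
    Finset.mem_univ, if_true, Pi.add_apply, eq_comm (a := i)]

lemma deg_add_single (k : Site n → ℕ) (s : Site n) :
    deg (k + Pi.single s 1) = deg k + Pi.single (ends s).1 1 + Pi.single (ends s).2 1 := by
  rw [deg_add, deg_single, add_assoc]

lemma sum_deg (k : Site n → ℕ) : ∑ i, deg k i = 2 * ∑ s, k s := by
  simp only [deg]
  rw [Finset.sum_comm, Finset.mul_sum]
  refine Finset.sum_congr rfl fun s _ => ?_
  simp [← Finset.mul_sum, Finset.sum_add_distrib, mul_comm]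

/-! ### Pairings that contain prescribed pairs -/

variable {d : Fin n → ℕ}

/-- The half-edges that belong to a list of ordered pairs of half-edges. -/
def used : List (HalfEdge d × HalfEdge d) → List (HalfEdge d)
  | [] => []
  | p :: l => p.1 :: p.2 :: used l

/-- The pairing contains all pairs of the list. -/
def Pairing.Contains (σ : Pairing d) (l : List (HalfEdge d × HalfEdge d)) : Prop :=
  ∀ p ∈ l, σ.1 p.1 = p.2

instance (σ : Pairing d) (l : List (HalfEdge d × HalfEdge d)) : Decidable (σ.Contains l) := by
  unfold Pairing.Contains
  infer_instance

lemma Pairing.contains_cons {σ : Pairing d} {p : HalfEdge d × HalfEdge d}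
    {l : List (HalfEdge d × HalfEdge d)} :
    σ.Contains (p :: l) ↔ σ.1 p.1 = p.2 ∧ σ.Contains l := by
  simp [Pairing.Contains]

/-- The number of pairings that contain all pairs of the list. -/
def numContaining (l : List (HalfEdge d × HalfEdge d)) : ℕ :=
  (Finset.univ.filter fun σ : Pairing d => σ.Contains l).card

/-- The number of half-edges at `i` outside the list. -/
def free (l : List (HalfEdge d × HalfEdge d)) (i : Fin n) : ℕ :=
  (Finset.univ.filter fun a : HalfEdge d => a ∉ used l ∧ a.1 = i).card

/-- The number of half-edges outside the list at the first end of `s` whose partner is at the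
second end. -/
def freeDarts (σ : Pairing d) (l : List (HalfEdge d × HalfEdge d)) (s : Site n) : ℕ :=
  (Finset.univ.filter fun a : HalfEdge d =>
    a ∉ used l ∧ a.1 = (ends s).1 ∧ (σ.1 a).1 = (ends s).2).card

lemma length_used (l : List (HalfEdge d × HalfEdge d)) : (used l).length = 2 * l.length := by
  induction l with
  | nil => rfl
  | cons p l ih => simp [used, ih]; ring

lemma used_fst {l : List (HalfEdge d × HalfEdge d)} {p : HalfEdge d × HalfEdge d} (h : p ∈ l) :
    p.1 ∈ used l := by
  induction l with
  | nil => simp at h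
  | cons q l ih =>
    rcases List.mem_cons.1 h with rfl | h
    · simp [used]
    · simp [used, ih h]

lemma used_snd {l : List (HalfEdge d × HalfEdge d)} {p : HalfEdge d × HalfEdge d} (h : p ∈ l) :
    p.2 ∈ used l := by
  induction l with
  | nil => simp at h
  | cons q l ih =>
    rcases List.mem_cons.1 h with rfl | h
    · simp [used]
    · simp [used, ih h]

lemma Pairing.Contains.apply_mem_used {σ : Pairing d} {l : List (HalfEdge d × HalfEdge d)}
    (h : σ.Contains l) {a : HalfEdge d} (ha : a ∈ used l) : σ.1 a ∈ used l := by
  induction l with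
  | nil => simp [used] at ha
  | cons p l ih =>
    obtain ⟨hp, hl⟩ := Pairing.contains_cons.1 h
    simp only [used, List.mem_cons] at ha ⊢
    rcases ha with rfl | rfl | ha
    · exact Or.inr (Or.inl hp)
    · exact Or.inl (by rw [← hp, (σ.2 _).2])
    · exact Or.inr (Or.inr (ih hl ha))

lemma Pairing.Contains.apply_mem_used_iff {σ : Pairing d} {l : List (HalfEdge d × HalfEdge d)}
    (h : σ.Contains l) {a : HalfEdge d} : σ.1 a ∈ used l ↔ a ∈ used l := by
  refine ⟨fun ha => ?_, h.apply_mem_used⟩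
  have := h.apply_mem_used ha
  rwa [(σ.2 a).2] at this

/-- The pairing obtained by interchanging two half-edges. -/
def Pairing.swap (b c : HalfEdge d) (σ : Pairing d) : Pairing d :=
  ⟨Equiv.swap b c * σ.1 * Equiv.swap b c, fun a => by
    refine ⟨fun h => ?_, ?_⟩
    · refine (σ.2 (Equiv.swap b c a)).1 ?_
      have := congrArg (Equiv.swap b c) h
      simpa [Equiv.Perm.mul_apply] using this
    · simp [Equiv.Perm.mul_apply, (σ.2 _).2]⟩

lemma Pairing.swap_swap (b c : HalfEdge d) (σ : Pairing d) :
    (σ.swap b c).swap b c = σ := by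
  apply Subtype.ext
  ext a : 1
  simp [Pairing.swap, Equiv.Perm.mul_apply]

lemma Pairing.Contains.swap {σ : Pairing d} {l : List (HalfEdge d × HalfEdge d)}
    {a b c : HalfEdge d} (h : σ.Contains ((a, b) :: l)) (hb : b ∉ used l) (hc : c ∉ used l)
    (hab : a ≠ b) (hac : a ≠ c) : (σ.swap b c).Contains ((a, c) :: l) := by
  rw [Pairing.contains_cons] at h ⊢
  refine ⟨?_, fun p hp => ?_⟩
  · simp [Pairing.swap, Equiv.Perm.mul_apply, Equiv.swap_apply_of_ne_of_ne hab hac, h.1]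
  · have h1 := used_fst hp
    have h2 := used_snd hp
    have e1 : Equiv.swap b c p.1 = p.1 :=
      Equiv.swap_apply_of_ne_of_ne (fun e => hb (e ▸ h1)) (fun e => hc (e ▸ h1))
    have e2 : Equiv.swap b c p.2 = p.2 :=
      Equiv.swap_apply_of_ne_of_ne (fun e => hb (e ▸ h2)) (fun e => hc (e ▸ h2))
    simp [Pairing.swap, Equiv.Perm.mul_apply, e1, h.2 p hp, e2]

/-- Conjugation by the transposition of `b` and `c` fixes the pairs of `l` and replaces the partner
`b` of `a` by `c`. -/
lemma numContaining_swap {l : List (HalfEdge d × HalfEdge d)} {a b c : HalfEdge d}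
    (hb : b ∉ used l) (hc : c ∉ used l) (hab : a ≠ b) (hac : a ≠ c) :
    numContaining ((a, b) :: l) = numContaining ((a, c) :: l) := by
  have swap_comm : ∀ σ : Pairing d, σ.swap b c = σ.swap c b := fun σ => by
    simp [Pairing.swap, Equiv.swap_comm]
  refine Finset.card_bij' (fun σ _ => σ.swap b c) (fun σ _ => σ.swap b c) ?_ ?_ ?_ ?_
  · intro σ h
    simp only [Finset.mem_filter, Finset.mem_univ, true_and] at h ⊢
    exact h.swap hb hc hab hac
  · intro σ h
    simp only [Finset.mem_filter, Finset.mem_univ, true_and] at h ⊢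
    rw [swap_comm]
    exact h.swap hc hb hac hab
  · intro σ _
    exact σ.swap_swap b c
  · intro σ _
    exact σ.swap_swap b c

lemma card_halfEdge (d : Fin n → ℕ) : Fintype.card (HalfEdge d) = total d := by
  simp [total]

/-- The partner of `a` is one of the `N - 1 - 2 |l|` other half-edges outside the list, and by
symmetry each choice is equally frequent. -/
lemma numContaining_cons {l : List (HalfEdge d × HalfEdge d)} {a b : HalfEdge d}
    (h : (used ((a, b) :: l)).Nodup) :
    (numContaining l : ℝ) = numContaining ((a, b) :: l) * ((total d : ℝ) - 1 - 2 * l.length) := by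
  simp only [used, List.nodup_cons, List.mem_cons, not_or] at h
  obtain ⟨⟨hab, ha⟩, hb, hl⟩ := h
  set S : Finset (HalfEdge d) := Finset.univ \ (insert a (used l).toFinset) with hS
  have hcard : (S.card : ℝ) = (total d : ℝ) - 1 - 2 * l.length := by
    have h1 : (insert a (used l).toFinset).card = 2 * l.length + 1 := by
      rw [Finset.card_insert_of_notMem (by simpa using ha), List.toFinset_card_of_nodup hl,
        length_used]
    have h2 := Finset.card_sdiff_add_card_eq_card (Finset.subset_univ (insert a (used l).toFinset))
    rw [h1, Finset.card_univ, card_halfEdge, ← hS] at h2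
    rw [← h2]
    push_cast
    ring
  have hsum : numContaining l = ∑ c ∈ S, numContaining ((a, c) :: l) := by
    unfold numContaining
    rw [Finset.card_eq_sum_card_fiberwise (f := fun σ : Pairing d => σ.1 a) (t := S)]
    · refine Finset.sum_congr rfl fun c _ => ?_
      congr 1
      ext σ
      simp [Pairing.contains_cons, and_comm]
    · intro σ hσ
      simp only [Finset.coe_filter, Finset.mem_univ, true_and, Set.mem_ofPred_eq] at hσ
      simp only [hS, Finset.coe_sdiff, Finset.coe_univ, Finset.coe_insert, List.coe_toFinset,
        Set.mem_sdiff, Set.mem_univ, true_and, Set.mem_insert_iff, Set.mem_ofPred_eq, not_or]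
      exact ⟨(σ.2 a).1, fun hm => ha (hσ.apply_mem_used_iff.1 hm)⟩
  rw [hsum, ← hcard, Finset.sum_congr rfl (g := fun _ => numContaining ((a, b) :: l))]
  · simp [mul_comm]
  · intro c hc
    simp only [hS, Finset.mem_sdiff, Finset.mem_univ, true_and, Finset.mem_insert,
      List.mem_toFinset, not_or] at hc
    exact numContaining_swap hc.2 hb (Ne.symm hc.1) hab

lemma free_cons {l : List (HalfEdge d × HalfEdge d)} {a b : HalfEdge d}
    (h : (used ((a, b) :: l)).Nodup) :
    (fun i => (free ((a, b) :: l) i : ℝ)) =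
      (fun i => (free l i : ℝ)) - Pi.single a.1 1 - Pi.single b.1 1 := by
  simp only [used, List.nodup_cons, List.mem_cons, not_or] at h
  obtain ⟨⟨hab, ha⟩, hb, hl⟩ := h
  funext i
  have key : ∀ x : HalfEdge d, (if x ∉ used ((a, b) :: l) ∧ x.1 = i then (1 : ℝ) else 0) =
      (if x ∉ used l ∧ x.1 = i then 1 else 0) - (if x = a then (if a.1 = i then 1 else 0) else 0)
        - (if x = b then (if b.1 = i then 1 else 0) else 0) := by
    intro x
    by_cases hxa : x = a
    · subst hxa
      simp [used, ha, hab]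
    · by_cases hxb : x = b
      · subst hxb
        simp [used, hb, hxa]
      · simp [used, hxa, hxb]
  simp only [free, Finset.card_filter, Nat.cast_sum, Nat.cast_ite, Nat.cast_one, Nat.cast_zero,
    key, Finset.sum_sub_distrib, Finset.sum_ite_eq', Finset.mem_univ, if_true, Pi.sub_apply,
    Pi.single_apply, eq_comm (a := i)]

/-- An edge contributes one dart per orientation; the reversed one fits a site only for a loop,
since `i < j` otherwise. This is the decrement of `freeDarts` when an edge at `s` is removed. -/
lemma ends_indicator (s s' : Site n) :
    ((if (ends s).1 = (ends s').1 ∧ (ends s).2 = (ends s').2 then 1 else 0) +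
      if (ends s).2 = (ends s').1 ∧ (ends s).1 = (ends s').2 then 1 else 0 : ℝ) =
      (Pi.single s (sym s) : Site n → ℝ) s' := by
  have h1 : ((ends s).1 = (ends s').1 ∧ (ends s).2 = (ends s').2) ↔ s' = s := by
    rcases s with i | ⟨⟨i, j⟩, hij⟩ <;> rcases s' with i' | ⟨⟨i', j'⟩, hij'⟩ <;>
      simp only [ends, Sum.elim_inl, Sum.elim_inr, Sum.inl.injEq, Sum.inr.injEq,
        Subtype.mk.injEq, Prod.mk.injEq, reduceCtorEq] <;> grind
  have h2 : ((ends s).2 = (ends s').1 ∧ (ends s).1 = (ends s').2) ↔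
      s' = s ∧ (ends s).1 = (ends s).2 := by
    rcases s with i | ⟨⟨i, j⟩, hij⟩ <;> rcases s' with i' | ⟨⟨i', j'⟩, hij'⟩ <;>
      simp only [ends, Sum.elim_inl, Sum.elim_inr, Sum.inl.injEq, Sum.inr.injEq,
        Subtype.mk.injEq, Prod.mk.injEq, reduceCtorEq] <;> grind
  simp only [h1, h2]
  by_cases h : s' = s
  · rcases s with i | ⟨⟨i, j⟩, hij⟩
    · norm_num [h, ends, sym]
    · have : i ≠ j := ne_of_lt hij
      simp [h, ends, sym, this]
  · simp [h]

lemma freeDarts_cons {σ : Pairing d} {l : List (HalfEdge d × HalfEdge d)} {a b : HalfEdge d}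
    {s : Site n} (h : (used ((a, b) :: l)).Nodup) (hσ : σ.1 a = b)
    (has : a.1 = (ends s).1) (hbs : b.1 = (ends s).2) :
    (fun t => (freeDarts σ ((a, b) :: l) t : ℝ)) =
      (fun t => (freeDarts σ l t : ℝ)) - Pi.single s (sym s) := by
  simp only [used, List.nodup_cons, List.mem_cons, not_or] at h
  obtain ⟨⟨hab, ha⟩, hb, hl⟩ := h
  have hσ' : σ.1 b = a := by rw [← hσ, (σ.2 a).2]
  funext t
  have key : ∀ x : HalfEdge d,
      (if x ∉ used ((a, b) :: l) ∧ x.1 = (ends t).1 ∧ (σ.1 x).1 = (ends t).2 then (1 : ℝ) else 0) =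
      (if x ∉ used l ∧ x.1 = (ends t).1 ∧ (σ.1 x).1 = (ends t).2 then 1 else 0)
        - (if x = a then (if a.1 = (ends t).1 ∧ b.1 = (ends t).2 then 1 else 0) else 0)
        - (if x = b then (if b.1 = (ends t).1 ∧ a.1 = (ends t).2 then 1 else 0) else 0) := by
    intro x
    by_cases hxa : x = a
    · subst hxa
      simp [used, ha, hab, hσ]
    · by_cases hxb : x = b
      · subst hxb
        simp [used, hb, hxa, hσ']
      · simp [used, hxa, hxb]
  simp only [freeDarts, Finset.card_filter, Nat.cast_sum, Nat.cast_ite, Nat.cast_one,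
    Nat.cast_zero, key, Finset.sum_sub_distrib, Finset.sum_ite_eq', Finset.mem_univ, if_true,
    Pi.sub_apply]
  rw [← ends_indicator s t, has, hbs]
  ring

/-! ### Factorial moments of the configuration model -/

/-- The pairs of distinct half-edges outside the list at the two ends of a site. -/
def freePairs (l : List (HalfEdge d × HalfEdge d)) (s : Site n) :
    Finset (HalfEdge d × HalfEdge d) :=
  Finset.univ.filter fun p => (used (p :: l)).Nodup ∧ p.1.1 = (ends s).1 ∧ p.2.1 = (ends s).2

lemma freeDarts_eq_card {σ : Pairing d} {l : List (HalfEdge d × HalfEdge d)}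
    (hl : (used l).Nodup) (hσ : σ.Contains l) (s : Site n) :
    freeDarts σ l s = ((freePairs l s).filter fun p => σ.1 p.1 = p.2).card := by
  refine Finset.card_bij' (fun a _ => (a, σ.1 a)) (fun p _ => p.1) ?_ ?_ ?_ ?_
  · intro a ha
    simp only [Finset.mem_filter, Finset.mem_univ, true_and] at ha
    simp only [freePairs, used, Finset.mem_filter, Finset.mem_univ, true_and, List.nodup_cons,
      List.mem_cons, not_or, and_true]
    exact ⟨⟨⟨(σ.2 a).1.symm, ha.1⟩, fun h => ha.1 (hσ.apply_mem_used_iff.1 h), hl⟩, ha.2⟩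
  · intro p hp
    simp only [freePairs, used, Finset.mem_filter, Finset.mem_univ, true_and, List.nodup_cons,
      List.mem_cons, not_or] at hp ⊢
    exact ⟨hp.1.1.1.2, hp.1.2.1, by rw [hp.2]; exact hp.1.2.2⟩
  · intro a _
    rfl
  · intro p hp
    simp only [Finset.mem_filter] at hp
    exact Prod.ext rfl hp.2

lemma card_freePairs {l : List (HalfEdge d × HalfEdge d)} (hl : (used l).Nodup) (s : Site n) :
    ((freePairs l s).card : ℝ) = free l (ends s).1 *
      ((fun i => (free l i : ℝ)) - Pi.single (ends s).1 1 : Fin n → ℝ) (ends s).2 := by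
  set A := Finset.univ.filter fun a : HalfEdge d => a ∉ used l ∧ a.1 = (ends s).1 with hA
  have h : freePairs l s = (A.sigma fun a => (Finset.univ.filter fun b : HalfEdge d =>
      b ∉ used l ∧ b.1 = (ends s).2).erase a).map (Equiv.sigmaEquivProd _ _).toEmbedding := by
    ext ⟨a, b⟩
    simp [freePairs, hA, used, hl]
    tauto
  rw [h, Finset.card_map, Finset.card_sigma]
  push_cast
  rw [Finset.sum_congr rfl (g := fun _ => ((fun i => (free l i : ℝ)) - Pi.single (ends s).1 1 :
    Fin n → ℝ) (ends s).2)]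
  · simp [free, hA, mul_sub]
  · intro a ha
    simp only [hA, Finset.mem_filter, Finset.mem_univ, true_and] at ha
    rw [Pi.sub_apply, Pi.single_apply]
    by_cases hs : (ends s).2 = (ends s).1
    · have hm : a ∈ Finset.univ.filter fun b : HalfEdge d => b ∉ used l ∧ b.1 = (ends s).2 := by
        simp [ha.1, ha.2, hs]
      rw [if_pos hs, Finset.cast_card_erase_of_mem hm]
      rfl
    · rw [if_neg hs, sub_zero, Finset.erase_eq_of_notMem]
      · rfl
      · simp [ha.2, Ne.symm hs]

/-- Joint factorial moments of the numbers of edges outside a list of pairs, over the pairings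
that contain these pairs. -/
lemma sum_prod_stepFactorial (t : ℕ) :
    ∀ (k : Site n → ℕ) (l : List (HalfEdge d × HalfEdge d)), ∑ s, k s = t → (used l).Nodup →
      (∑ σ ∈ Finset.univ.filter fun σ : Pairing d => σ.Contains l,
        ∏ s, stepFactorial (sym s) (freeDarts σ l s) (k s)) *
        ∏ r ∈ Finset.range t, ((total d : ℝ) - 1 - 2 * l.length - 2 * r) =
      (∏ i, stepFactorial 1 (free l i) (deg k i)) * numContaining l := by
  induction t with
  | zero =>
    intro k l hk hl
    have : k = 0 := by
      funext s
      simpa using (Finset.sum_eq_zero_iff.1 hk) s (Finset.mem_univ s)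
    subst this
    have hd : deg (0 : Site n → ℕ) = 0 := by ext; simp [deg]
    simp [hd, numContaining]
  | succ t ih =>
    intro k l hk hl
    obtain ⟨s, hs⟩ : ∃ s, k s ≠ 0 := by
      by_contra! h
      simp [h] at hk
    obtain ⟨k', rfl⟩ : ∃ k' : Site n → ℕ, k = k' + Pi.single s 1 := by
      refine ⟨k - Pi.single s 1, ?_⟩
      ext s'
      by_cases h : s' = s
      · subst h
        simp
        lia
      · simp [Pi.single_eq_of_ne h]
    have hk' : ∑ s, k' s = t := by
      simpa [Finset.sum_add_distrib] using hk
    have hP : ∏ r ∈ Finset.range (t + 1), ((total d : ℝ) - 1 - 2 * l.length - 2 * r) =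
        ((total d : ℝ) - 1 - 2 * l.length) *
          ∏ r ∈ Finset.range t, ((total d : ℝ) - 1 - 2 * (l.length + 1 : ℕ) - 2 * r) := by
      rw [Finset.prod_range_succ', mul_comm]
      congr 1
      · simp
      · refine Finset.prod_congr rfl fun r _ => ?_
        push_cast
        ring
    -- The factor `freeDarts σ l s` split off at `s` counts the pairs of `σ` in `freePairs l s`.
    -- Summing over these pairs outside moves one prescribed edge from `k` to the list.
    have hL : ∑ σ ∈ Finset.univ.filter fun σ : Pairing d => σ.Contains l,
        ∏ s', stepFactorial (sym s') (freeDarts σ l s') ((k' + Pi.single s 1 : Site n → ℕ) s') =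
        ∑ p ∈ freePairs l s, ∑ σ ∈ Finset.univ.filter fun σ : Pairing d => σ.Contains (p :: l),
          ∏ s', stepFactorial (sym s') (freeDarts σ (p :: l) s') (k' s') := by
      have h1 : ∀ p ∈ freePairs l s,
          ∑ σ ∈ Finset.univ.filter fun σ : Pairing d => σ.Contains (p :: l),
            ∏ s', stepFactorial (sym s') (freeDarts σ (p :: l) s') (k' s') =
          ∑ σ ∈ Finset.univ.filter fun σ : Pairing d => σ.Contains l,
            if σ.1 p.1 = p.2 then ∏ s', stepFactorial (sym s')
              (((fun t => (freeDarts σ l t : ℝ)) - Pi.single s (sym s) : Site n → ℝ) s') (k' s')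
              else 0 := by
        intro p hp
        simp only [freePairs, Finset.mem_filter, Finset.mem_univ, true_and] at hp
        rw [← Finset.sum_filter, Finset.filter_filter]
        refine Finset.sum_congr ?_ fun σ hσ => ?_
        · ext σ
          simp [Pairing.contains_cons, and_comm]
        · simp only [Finset.mem_filter, Finset.mem_univ, true_and] at hσ
          rw [← freeDarts_cons hp.1 hσ.2 hp.2.1 hp.2.2]
      rw [Finset.sum_congr rfl h1, Finset.sum_comm]
      refine Finset.sum_congr rfl fun σ hσ => ?_
      simp only [Finset.mem_filter, Finset.mem_univ, true_and] at hσ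
      rw [prod_stepFactorial_add_single (fun s => sym s) (fun s => (freeDarts σ l s : ℝ)) k' s,
        freeDarts_eq_card hl hσ, ← Finset.sum_filter, Finset.sum_const, nsmul_eq_mul]
    have hp : ∀ p ∈ freePairs l s,
        (∑ σ ∈ Finset.univ.filter fun σ : Pairing d => σ.Contains (p :: l),
          ∏ s', stepFactorial (sym s') (freeDarts σ (p :: l) s') (k' s')) *
          ∏ r ∈ Finset.range (t + 1), ((total d : ℝ) - 1 - 2 * l.length - 2 * r) =
        (∏ i, stepFactorial 1 (((fun i => (free l i : ℝ)) - Pi.single (ends s).1 1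
          - Pi.single (ends s).2 1 : Fin n → ℝ) i) (deg k' i)) * numContaining l := by
      rintro ⟨a, b⟩ hp
      simp only [freePairs, Finset.mem_filter, Finset.mem_univ, true_and] at hp
      have h1 := ih k' ((a, b) :: l) hk' hp.1
      rw [List.length_cons] at h1
      rw [hP, mul_left_comm, h1, numContaining_cons hp.1, ← hp.2.1, ← hp.2.2, ← free_cons hp.1]
      ring
    rw [hL, Finset.sum_mul, Finset.sum_congr rfl hp, Finset.sum_const, nsmul_eq_mul,
      card_freePairs hl, deg_add_single,
      add_right_comm, prod_stepFactorial_add_single (fun _ => 1) (fun i => (free l i : ℝ)),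
      prod_stepFactorial_add_single (fun _ => 1)]
    ring

/-- Both halves of a loop at `i` are counted, but only the half at `i` of an edge between `i < j`.
This is why the falling factorials above have step `sym s`. -/
lemma freeDarts_nil (σ : Pairing d) (s : Site n) :
    (freeDarts σ [] s : ℝ) = sym s * σ.counts s := by
  have himage : ∀ i j, σ.mult i j = ((Finset.univ.filter fun a : HalfEdge d =>
      s(a.1, (σ.1 a).1) = s(i, j)).image fun a => s(a, σ.1 a)).card := by
    intro i j
    rw [Pairing.mult, Pairing.edges, Finset.filter_image]
    rfl
  rcases s with i | ⟨⟨i, j⟩, hij⟩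
  · have h : freeDarts σ [] (Sum.inl i) = (Finset.univ.filter fun a : HalfEdge d =>
        s(a.1, (σ.1 a).1) = s(i, i)).card := by
      simp [freeDarts, used, ends]
    rw [h, Finset.card_eq_sum_card_image fun a => s(a, σ.1 a)]
    simp only [sym, Pairing.counts, Sum.elim_inl, himage]
    rw [Finset.sum_congr rfl (g := fun _ => 2)]
    · simp [mul_comm]
    · intro e he
      obtain ⟨a, ha, rfl⟩ := Finset.mem_image.1 he
      rw [← Finset.card_pair (σ.2 a).1.symm]
      congr 1
      ext b
      have h1 := (σ.2 a).2
      simp only [Finset.mem_filter, Finset.mem_univ, true_and, Sym2.eq_iff, Finset.mem_insert,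
        Finset.mem_singleton, or_self] at ha ⊢
      constructor
      · rintro ⟨_, h | h⟩
        · exact Or.inl h.1
        · exact Or.inr h.1
      · rintro (rfl | rfl)
        · exact ⟨ha, Or.inl ⟨rfl, rfl⟩⟩
        · exact ⟨⟨ha.2, by rw [h1]; exact ha.1⟩, Or.inr ⟨rfl, h1⟩⟩
  · have hne : i ≠ j := ne_of_lt hij
    simp only [sym, Pairing.counts, Sum.elim_inr, himage, one_mul]
    norm_cast
    have h : ((Finset.univ.filter fun a : HalfEdge d => s(a.1, (σ.1 a).1) = s(i, j)).image
        fun a => s(a, σ.1 a)) = (Finset.univ.filter fun a : HalfEdge d =>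
          a ∉ used ([] : List (HalfEdge d × HalfEdge d)) ∧ a.1 = i ∧ (σ.1 a).1 = j).image
            fun a => s(a, σ.1 a) := by
      ext e
      simp only [Finset.mem_image, Finset.mem_filter, Finset.mem_univ, true_and, used,
        List.not_mem_nil, not_false_eq_true, Sym2.eq_iff]
      constructor
      · rintro ⟨a, h | h, rfl⟩
        · exact ⟨a, h, rfl⟩
        · exact ⟨σ.1 a, ⟨h.2, by rw [(σ.2 a).2]; exact h.1⟩, by rw [(σ.2 a).2, Sym2.eq_swap]⟩
      · rintro ⟨a, h, rfl⟩
        exact ⟨a, Or.inl h, rfl⟩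
    rw [h, Finset.card_image_of_injOn]
    · rfl
    · intro a ha b hb hab
      simp only [Finset.coe_filter, Finset.mem_univ, true_and, Set.mem_ofPred_eq, used,
        List.not_mem_nil, not_false_eq_true] at ha hb
      rcases Sym2.eq_iff.1 hab with h | h
      · exact h.1
      · exact absurd (ha.1.symm.trans ((congrArg Sigma.fst h.1).trans hb.2)) hne

/-- The product of the falling factorials of the counts `x s`. -/
noncomputable def fallingProd (k x : Site n → ℕ) : ℝ := ∏ s, stepFactorial 1 (x s) (k s)

lemma sum_fallingProd_counts (d : Fin n → ℕ) (k : Site n → ℕ) :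
    (∑ σ : Pairing d, fallingProd k σ.counts) * (∏ s, sym s ^ k s) *
        ∏ r ∈ Finset.range (∑ s, k s), ((total d : ℝ) - 1 - 2 * r) =
      (∏ i, ((d i).descFactorial (deg k i) : ℝ)) * Fintype.card (Pairing d) := by
  have h := sum_prod_stepFactorial (∑ s, k s) k ([] : List (HalfEdge d × HalfEdge d)) rfl (by
    simp [used])
  have h1 : ∀ i, free ([] : List (HalfEdge d × HalfEdge d)) i = d i := by
    intro i
    have : (Finset.univ.filter fun a : HalfEdge d => a.1 = i) =
        (Finset.univ : Finset (Fin (d i))).map ⟨fun x => (⟨i, x⟩ : HalfEdge d),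
          fun x y h => by simpa using h⟩ := by
      ext ⟨j, x⟩
      simp only [Finset.mem_filter, Finset.mem_univ, true_and, Finset.mem_map]
      constructor
      · rintro rfl
        exact ⟨x, rfl⟩
      · rintro ⟨y, hy⟩
        exact (congrArg Sigma.fst hy).symm
    simp [free, used, this]
  simp only [freeDarts_nil, stepFactorial_mul, Finset.prod_mul_distrib, h1, List.length_nil,
    Nat.cast_zero, mul_zero, sub_zero, stepFactorial_natCast, numContaining,
    Pairing.Contains, List.not_mem_nil, false_imp_iff, implies_true, Finset.filter_true,
    ← Finset.mul_sum, Finset.card_univ] at h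
  rw [← h]
  simp only [fallingProd, stepFactorial_natCast]
  ring

/-- Identifying the half-edges with `Fin M × Bool`, flipping the Boolean is a pairing. -/
lemma card_pairing_pos (h : Even (total d)) : 0 < Fintype.card (Pairing d) := by
  obtain ⟨M, hM⟩ := h
  have e : HalfEdge d ≃ Fin M × Bool := by
    refine Fintype.equivOfCardEq ?_
    rw [card_halfEdge, hM]
    simp [mul_two]
  let f : HalfEdge d → HalfEdge d := fun a => e.symm ((e a).1, !(e a).2)
  have hf : ∀ a, f (f a) = a := fun a => by simp [f]
  refine Fintype.card_pos_iff.2 ⟨⟨⟨f, f, hf, hf⟩, fun a => ⟨fun h => ?_, hf a⟩⟩⟩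
  have h2 := congrArg (fun x => (e x).2) h
  simp [f] at h2

/-! ### Factorial moments of the Poisson variables -/

lemma hasSum_poisson_descFactorial (r : ℝ≥0) (k : ℕ) :
    HasSum (fun x : ℕ => Real.exp (-r) * r ^ x / x.factorial * (x.descFactorial k : ℝ))
      ((r : ℝ) ^ k) := by
  -- The terms below `k` vanish; after the shift the series is `r ^ k` times the total Poisson mass.
  rw [← hasSum_nat_add_iff' k]
  have h0 : ∑ i ∈ Finset.range k,
      Real.exp (-r) * (r : ℝ) ^ i / i.factorial * (i.descFactorial k : ℝ) = 0 :=
    Finset.sum_eq_zero fun i hi => by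
      simp [Nat.descFactorial_of_lt (Finset.mem_range.1 hi)]
  rw [h0, sub_zero]
  have h := (hasSum_one_poissonMeasure r).mul_left ((r : ℝ) ^ k)
  rw [mul_one] at h
  refine h.congr_fun fun x => ?_
  have hf := Nat.factorial_mul_descFactorial (Nat.le_add_left k x)
  rw [Nat.add_sub_cancel] at hf
  rw [← hf]
  have h1 : (x.factorial : ℝ) ≠ 0 := by positivity
  have h2 : ((x + k).descFactorial k : ℝ) ≠ 0 := by
    exact_mod_cast (Nat.descFactorial_pos.2 (Nat.le_add_left k x)).ne'
  push_cast
  field_simp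
  ring

lemma integrable_stepFactorial_poisson (r : ℝ≥0) (k : ℕ) :
    Integrable (fun x : ℕ => stepFactorial 1 (x : ℝ) k) (poissonMeasure r) := by
  rw [integrable_poissonMeasure_iff]
  simp only [stepFactorial_natCast]
  refine (hasSum_poisson_descFactorial r k).summable.congr fun x => ?_
  simp

lemma integral_stepFactorial_poisson (r : ℝ≥0) (k : ℕ) :
    ∫ x : ℕ, stepFactorial 1 (x : ℝ) k ∂(poissonMeasure r) = (r : ℝ) ^ k := by
  rw [integral_poissonMeasure]
  simp only [stepFactorial_natCast, smul_eq_mul]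
  exact (hasSum_poisson_descFactorial r k).tsum_eq

lemma integrable_fallingProd (d : Fin n → ℕ) (k : Site n → ℕ) :
    Integrable (fallingProd k) (poissonLaw d) :=
  Integrable.fintype_prod (f := fun s (x : ℕ) => stepFactorial 1 (x : ℝ) (k s))
    fun _ => integrable_stepFactorial_poisson _ _

lemma integral_fallingProd (d : Fin n → ℕ) (k : Site n → ℕ) :
    ∫ x, fallingProd k x ∂(poissonLaw d) = ∏ s, (rate d s : ℝ) ^ k s := by
  unfold fallingProd poissonLaw
  rw [integral_fintype_prod_eq_prod (f := fun s (x : ℕ) => stepFactorial 1 (x : ℝ) (k s))]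
  simp [integral_stepFactorial_poisson]

/-! ### Falling factorials against powers of the geometric mean -/

/-- Telescoping: the factors are exchanged one at a time, each exchange costing `ε * ∏ M i`. -/
lemma abs_prod_sub_prod_le {ι : Type*} (s : Finset ι) {a b M : ι → ℝ} {ε : ℝ}
    (ha : ∀ i ∈ s, 0 ≤ a i) (hb : ∀ i ∈ s, 0 ≤ b i) (haM : ∀ i ∈ s, a i ≤ M i)
    (hbM : ∀ i ∈ s, b i ≤ M i) (h : ∀ i ∈ s, |a i - b i| ≤ ε * M i) :
    |∏ i ∈ s, a i - ∏ i ∈ s, b i| ≤ s.card * ε * ∏ i ∈ s, M i := by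
  classical
  induction s using Finset.induction_on with
  | empty => simp
  | insert j s hj ih =>
    have hs : ∀ {i}, i ∈ s → i ∈ insert j s := fun hi => Finset.mem_insert_of_mem hi
    have hjm := Finset.mem_insert_self j s
    have ih := ih (fun i hi => ha i (hs hi)) (fun i hi => hb i (hs hi))
      (fun i hi => haM i (hs hi)) (fun i hi => hbM i (hs hi)) (fun i hi => h i (hs hi))
    have hbP : ∏ i ∈ s, b i ≤ ∏ i ∈ s, M i :=
      Finset.prod_le_prod (fun i hi => hb i (hs hi)) (fun i hi => hbM i (hs hi))
    have hb0 : 0 ≤ ∏ i ∈ s, b i := Finset.prod_nonneg fun i hi => hb i (hs hi)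
    rw [Finset.prod_insert hj, Finset.prod_insert hj, Finset.prod_insert hj,
      Finset.card_insert_of_notMem hj]
    have e : a j * ∏ i ∈ s, a i - b j * ∏ i ∈ s, b i =
        a j * (∏ i ∈ s, a i - ∏ i ∈ s, b i) + (a j - b j) * ∏ i ∈ s, b i := by ring
    rw [e]
    refine (abs_add_le _ _).trans ?_
    rw [abs_mul, abs_mul, abs_of_nonneg (ha j hjm), abs_of_nonneg hb0]
    have h1 : a j * |∏ i ∈ s, a i - ∏ i ∈ s, b i| ≤ M j * (s.card * ε * ∏ i ∈ s, M i) :=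
      mul_le_mul (haM j hjm) ih (abs_nonneg _) ((ha j hjm).trans (haM j hjm))
    have h2 : |a j - b j| * ∏ i ∈ s, b i ≤ ε * M j * ∏ i ∈ s, M i :=
      mul_le_mul (h j hjm) hbP hb0 ((abs_nonneg _).trans (h j hjm))
    refine (add_le_add h1 h2).trans_eq ?_
    push_cast
    ring

/-- The geometric mean of `x` and `x - 1`. -/
noncomputable def geomMean (x : ℕ) : ℝ := √((x * (x - 1) : ℕ) : ℝ)

lemma geomMean_nonneg (x : ℕ) : 0 ≤ geomMean x := Real.sqrt_nonneg _

lemma geomMean_sq (x : ℕ) : geomMean x ^ 2 = ((x * (x - 1) : ℕ) : ℝ) :=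
  Real.sq_sqrt (Nat.cast_nonneg _)

lemma geomMean_le (x : ℕ) : geomMean x ≤ x := by
  refine Real.sqrt_le_iff.2 ⟨Nat.cast_nonneg _, ?_⟩
  norm_cast
  rw [sq]
  exact Nat.mul_le_mul_left _ (Nat.sub_le _ _)

lemma sub_one_le_geomMean (x : ℕ) : (x : ℝ) - 1 ≤ geomMean x := by
  rcases x with _ | x
  · linarith [geomMean_nonneg 0, Nat.cast_zero (R := ℝ)]
  · refine Real.le_sqrt_of_sq_le ?_
    push_cast [Nat.add_sub_cancel]
    nlinarith [(Nat.cast_nonneg x : (0 : ℝ) ≤ x)]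

lemma geomMean_pow_two (x : ℕ) : geomMean x ^ 2 = (x.descFactorial 2 : ℝ) := by
  rw [geomMean_sq]
  norm_cast
  simp [Nat.descFactorial, mul_comm]

lemma descFactorial_le (x D : ℕ) : (x.descFactorial D : ℝ) ≤ (x : ℝ) ^ D := by
  exact_mod_cast Nat.descFactorial_le_pow x D

/-- Each of the `D` factors `x - i` and each factor `geomMean x` lies within `D` below `x`, so they
differ by at most `D = (D / x) * x`. -/
lemma abs_descFactorial_sub_le {x : ℕ} (hx : x ≠ 0) (D : ℕ) :
    |(x.descFactorial D : ℝ) - geomMean x ^ D| ≤ D * (D / x) * (x : ℝ) ^ D := by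
  have hx' : (0 : ℝ) < x := by positivity
  have h := abs_prod_sub_prod_le (Finset.range D) (a := fun i => ((x - i : ℕ) : ℝ))
    (b := fun _ => geomMean x) (M := fun _ => (x : ℝ)) (ε := D / x)
    (fun _ _ => Nat.cast_nonneg _) (fun _ _ => geomMean_nonneg x)
    (fun i _ => Nat.cast_le.2 (Nat.sub_le x i)) (fun _ _ => geomMean_le x) ?_
  · rw [Nat.descFactorial_eq_prod_range]
    push_cast
    simpa using h
  · intro i hi
    have hiD : (i : ℝ) + 1 ≤ D := by exact_mod_cast Finset.mem_range.1 hi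
    have h0 : (0 : ℝ) ≤ i := Nat.cast_nonneg i
    have h1 := geomMean_le x
    have h2 := sub_one_le_geomMean x
    have h3 := geomMean_nonneg x
    rw [div_mul_cancel₀ _ hx'.ne', abs_le]
    rcases le_total i x with hix | hix
    · rw [Nat.cast_sub hix]
      constructor <;> linarith
    · rw [Nat.sub_eq_zero_of_le hix, Nat.cast_zero]
      have : (x : ℝ) ≤ i := by exact_mod_cast hix
      constructor <;> linarith

/-- The factor two of a loop cancels the one half in its rate, which gives one formula for loops and
edges. -/
lemma rate_eq (d : Fin n → ℕ) (s : Site n) :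
    (rate d s : ℝ) * sym s =
      geomMean (d (ends s).1) * geomMean (d (ends s).2) / total d := by
  rcases s with i | ⟨⟨i, j⟩, hij⟩
  · simp only [rate, sym, ends, Sum.elim_inl, NNReal.coe_div, NNReal.coe_natCast]
    rw [← sq, geomMean_pow_two, Nat.descFactorial_eq_factorial_mul_choose]
    push_cast [Nat.factorial]
    ring
  · simp only [rate, sym, ends, Sum.elim_inr, NNReal.coe_div, NNReal.coe_natCast,
      Real.coe_sqrt, mul_one, geomMean]
    rw [← Real.sqrt_mul (Nat.cast_nonneg _)]
    push_cast
    rfl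

lemma prod_ends_pow (k : Site n → ℕ) (r : Fin n → ℝ) :
    ∏ s, (r (ends s).1 * r (ends s).2) ^ k s = ∏ i, r i ^ deg k i := by
  simp only [deg, ← Finset.prod_pow_eq_pow_sum]
  rw [Finset.prod_comm]
  refine Finset.prod_congr rfl fun s _ => ?_
  simp only [mul_comm (k s), pow_mul, Finset.prod_pow, pow_add, Finset.prod_mul_distrib]
  simp [Finset.prod_ite_eq, pow_ite]

lemma prod_rate_pow (d : Fin n → ℕ) (k : Site n → ℕ) :
    (∏ s, (rate d s : ℝ) ^ k s) * ∏ s, sym s ^ k s =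
      (∏ i, geomMean (d i) ^ deg k i) / (total d : ℝ) ^ ∑ s, k s := by
  rw [← prod_ends_pow k fun i => geomMean (d i), ← Finset.prod_pow_eq_pow_sum,
    ← Finset.prod_div_distrib, ← Finset.prod_mul_distrib]
  refine Finset.prod_congr rfl fun s _ => ?_
  rw [← mul_pow, rate_eq, div_pow]

/-! ### Comparison of the factorial moments -/

/-- The product of `d i ^ 2 / N` over the vertices that are not isolated in `k`. -/
noncomputable def weight (d : Fin n → ℕ) (k : Site n → ℕ) : ℝ :=
  ∏ i, if deg k i = 0 then 1 else (d i : ℝ) ^ 2 / total d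

lemma weight_nonneg (d : Fin n → ℕ) (k : Site n → ℕ) : 0 ≤ weight d k :=
  Finset.prod_nonneg fun i _ => by split_ifs <;> positivity

/-- The constant in the comparison of joint factorial moments of order `t`. -/
noncomputable def factorialConst (C : ℝ) (t : ℕ) : ℝ :=
  (2 * t ^ 2 * (2 * t) ^ t + 4 * t ^ 3) * C ^ t

/-- The vertices that are not isolated in `k`. -/
def support (k : Site n → ℕ) : Finset (Fin n) := Finset.univ.filter fun i => deg k i ≠ 0

lemma prod_eq_prod_support (k : Site n → ℕ) (f : Fin n → ℕ → ℝ) (hf : ∀ i, f i 0 = 1) :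
    ∏ i, f i (deg k i) = ∏ i ∈ support k, f i (deg k i) := by
  symm
  refine Finset.prod_subset (Finset.subset_univ _) fun i _ hi => ?_
  have : deg k i = 0 := by simpa [support] using hi
  rw [this, hf]

lemma sum_support_deg (k : Site n → ℕ) : ∑ i ∈ support k, deg k i = 2 * ∑ s, k s := by
  rw [← sum_deg]
  exact Finset.sum_subset (Finset.subset_univ _) fun i _ hi => by simpa [support] using hi

section Bounds

variable {k : Site n → ℕ} (hk : ∀ i, deg k i ≠ 1)

include hk

lemma two_le_deg {i : Fin n} (hi : i ∈ support k) : 2 ≤ deg k i := by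
  have h1 := hk i
  have h2 : deg k i ≠ 0 := by simpa [support] using hi
  lia

lemma sum_deg_sub_two :
    ∑ i ∈ support k, (deg k i - 2) + 2 * (support k).card = 2 * ∑ s, k s := by
  rw [← sum_support_deg, mul_comm, ← smul_eq_mul (support k).card, ← Finset.sum_const,
    ← Finset.sum_add_distrib]
  exact Finset.sum_congr rfl fun i hi => Nat.sub_add_cancel (two_le_deg hk hi)

/-- With `v` non-isolated vertices the excess degrees `deg k i - 2` sum to `2 (t - v)`; `weight`
absorbs `v` of the `t` factors `N`, and each of the others meets a `Δ ^ 2`. -/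
lemma prod_sq_mul_pow (hN : 0 < total d) (Δ : ℝ) :
    ∏ i ∈ support k, ((d i : ℝ) ^ 2 * Δ ^ (deg k i - 2)) =
      weight d k * (Δ ^ 2 / total d) ^ (∑ s, k s - (support k).card) *
        (total d : ℝ) ^ ∑ s, k s := by
  have hN' : (total d : ℝ) ≠ 0 := by positivity
  have h := sum_deg_sub_two hk
  have hw : weight d k = (∏ i ∈ support k, (d i : ℝ) ^ 2) / (total d : ℝ) ^ (support k).card := by
    rw [weight, prod_eq_prod_support k (fun i D => if D = 0 then 1 else (d i : ℝ) ^ 2 / total d)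
      (by simp), ← Finset.prod_const, ← Finset.prod_div_distrib]
    refine Finset.prod_congr rfl fun i hi => if_neg ?_
    simpa [support] using hi
  rw [Finset.prod_mul_distrib, Finset.prod_pow_eq_pow_sum, hw, div_pow, ← pow_mul]
  obtain ⟨e, he⟩ : ∃ e, ∑ s, k s = (support k).card + e := ⟨∑ s, k s - (support k).card, by lia⟩
  have h2 : ∑ i ∈ support k, (deg k i - 2) = 2 * e := by lia
  rw [h2, he, Nat.add_sub_cancel_left, pow_add (total d : ℝ)]
  field_simp

end Bounds

lemma prod_odd_pos {N t : ℕ} (h : 2 * t ≤ N) :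
    0 < ∏ r ∈ Finset.range t, ((N : ℝ) - 1 - 2 * r) := by
  refine Finset.prod_pos fun r hr => ?_
  have h1 : r + 1 ≤ t := Finset.mem_range.1 hr
  have h2 : (2 * (r + 1) : ℝ) ≤ N := by exact_mod_cast (by lia : 2 * (r + 1) ≤ N)
  linarith

lemma abs_inv_prod_odd_sub_le {N t : ℕ} (hN : 0 < N) (h : 2 * t ≤ N) :
    |(∏ r ∈ Finset.range t, ((N : ℝ) - 1 - 2 * r))⁻¹ - ((N : ℝ) ^ t)⁻¹| ≤
      2 * t ^ 2 * (2 * t) ^ t / N * ((N : ℝ) ^ t)⁻¹ := by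
  have hN' : (0 : ℝ) < N := by exact_mod_cast hN
  have hP := prod_odd_pos h
  have h2t : (2 * t : ℝ) ≤ N := by exact_mod_cast h
  have hr1 : ∀ r ∈ Finset.range t, (r : ℝ) + 1 ≤ t := fun r hr => by
    exact_mod_cast Finset.mem_range.1 hr
  have hlow : (N : ℝ) ^ t ≤
      (∏ r ∈ Finset.range t, ((N : ℝ) - 1 - 2 * r)) * (2 * t : ℝ) ^ t := by
    have : ∏ r ∈ Finset.range t, (N : ℝ) ≤
        ∏ r ∈ Finset.range t, (((N : ℝ) - 1 - 2 * r) * (2 * t)) := by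
      refine Finset.prod_le_prod (fun _ _ => hN'.le) fun r hr => ?_
      have h1 := hr1 r hr
      have h0 : (0 : ℝ) ≤ r := Nat.cast_nonneg r
      -- The worst factor is `N - 2t + 1`, and `2t (N - 2t + 1) - N = (2t - 1)(N - 2t)`.
      nlinarith [mul_nonneg (by linarith : (0 : ℝ) ≤ 2 * t - 1) (sub_nonneg.2 h2t)]
    simpa [Finset.prod_mul_distrib] using this
  have hdiff := abs_prod_sub_prod_le (Finset.range t) (a := fun _ => (N : ℝ))
    (b := fun r => (N : ℝ) - 1 - 2 * r) (M := fun _ => (N : ℝ)) (ε := 2 * t / N)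
    (fun _ _ => hN'.le) (fun r hr => by linarith [hr1 r hr]) (fun _ _ => le_rfl)
    (fun r _ => by linarith [(Nat.cast_nonneg r : (0 : ℝ) ≤ r)]) (fun r hr => by
      rw [div_mul_cancel₀ _ hN'.ne', abs_of_nonneg (by
        linarith [(Nat.cast_nonneg r : (0 : ℝ) ≤ r)])]
      linarith [hr1 r hr])
  simp only [Finset.prod_const, Finset.card_range] at hdiff
  set P := ∏ r ∈ Finset.range t, ((N : ℝ) - 1 - 2 * r)
  have hNt : (0 : ℝ) < (N : ℝ) ^ t := by positivity
  have hinv : P⁻¹ ≤ (2 * t : ℝ) ^ t * ((N : ℝ) ^ t)⁻¹ := by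
    rw [inv_le_iff_one_le_mul₀ hP, mul_assoc, mul_comm _ P, ← mul_assoc, mul_comm _ P,
      ← div_eq_mul_inv, le_div_iff₀ hNt, one_mul]
    exact hlow
  have e : P⁻¹ - ((N : ℝ) ^ t)⁻¹ = ((N : ℝ) ^ t - P) * ((N : ℝ) ^ t)⁻¹ * P⁻¹ := by
    field_simp
  rw [e, abs_mul, abs_mul, abs_of_pos (inv_pos.2 hP), abs_of_pos (inv_pos.2 hNt)]
  calc |(N : ℝ) ^ t - P| * ((N : ℝ) ^ t)⁻¹ * P⁻¹
      ≤ (t * (2 * t / N) * (N : ℝ) ^ t) * ((N : ℝ) ^ t)⁻¹ *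
        ((2 * t : ℝ) ^ t * ((N : ℝ) ^ t)⁻¹) := by gcongr
    _ = 2 * t ^ 2 * (2 * t) ^ t / N * ((N : ℝ) ^ t)⁻¹ := by
      field_simp

section Bounds

variable {k : Site n → ℕ} (hk : ∀ i, deg k i ≠ 1) {C Δ : ℝ} (hN : 0 < total d) (hC : 1 ≤ C)
  (hΔ : 1 ≤ Δ) (hd : ∀ i, (d i : ℝ) ≤ Δ) (hΔC : Δ ^ 2 ≤ C * total d)

include hk hd in
lemma pow_deg_le {i : Fin n} (hi : i ∈ support k) :
    (d i : ℝ) ^ deg k i ≤ (d i : ℝ) ^ 2 * Δ ^ (deg k i - 2) := by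
  obtain ⟨e, he⟩ := Nat.exists_eq_add_of_le (two_le_deg hk hi)
  rw [he, Nat.add_sub_cancel_left, pow_add]
  gcongr
  exact hd i

include hk hN hC hΔ hd hΔC in
lemma prod_descFactorial_le :
    ∏ i, ((d i).descFactorial (deg k i) : ℝ) ≤
      weight d k * C ^ (∑ s, k s) * (total d : ℝ) ^ ∑ s, k s := by
  have hN' : (0 : ℝ) < total d := by exact_mod_cast hN
  rw [prod_eq_prod_support k (fun i D => ((d i).descFactorial D : ℝ)) (by simp)]
  calc _ ≤ ∏ i ∈ support k, ((d i : ℝ) ^ 2 * Δ ^ (deg k i - 2)) :=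
        Finset.prod_le_prod (fun _ _ => Nat.cast_nonneg _)
          fun i hi => (descFactorial_le _ _).trans (pow_deg_le hk hd hi)
    _ = _ := prod_sq_mul_pow hk hN Δ
    _ ≤ _ := by
      have h1 : Δ ^ 2 / total d ≤ C := (div_le_iff₀ hN').2 hΔC
      have h2 : (Δ ^ 2 / total d) ^ (∑ s, k s - (support k).card) ≤ C ^ (∑ s, k s) :=
        (pow_le_pow_left₀ (by positivity) h1 _).trans (pow_le_pow_right₀ hC (Nat.sub_le _ _))
      have := weight_nonneg d k
      gcongr

include hk hΔ hd in
-- The relative error is of order `1 / d i`, but measured against the larger bound `d i ^ 2 * Δ ^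
-- (deg k i - 2)` it is of order `1 / Δ`: from degree three on, the lost factor `d i` can be taken
-- from the excess. Degree two has no excess, but there the error is zero.
lemma abs_descFactorial_sub_geomMean_le {i : Fin n} (hi : i ∈ support k) :
    |((d i).descFactorial (deg k i) : ℝ) - geomMean (d i) ^ deg k i| ≤
      (2 * ∑ s, k s : ℕ) ^ 2 / Δ * ((d i : ℝ) ^ 2 * Δ ^ (deg k i - 2)) := by
  have hΔ0 : 0 < Δ := by linarith
  have h2 := two_le_deg hk hi
  have hle : deg k i ≤ 2 * ∑ s, k s := by
    rw [← sum_deg]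
    exact Finset.single_le_sum (f := deg k) (fun _ _ => Nat.zero_le _) (Finset.mem_univ i)
  rcases h2.eq_or_lt with h2 | h2
  · rw [← h2, geomMean_pow_two, sub_self, abs_zero]
    positivity
  by_cases hx : d i = 0
  · have h0 : geomMean 0 = 0 := by simp [geomMean]
    rw [hx, h0, Nat.descFactorial_of_lt (by lia), zero_pow (by lia)]
    simp
  refine (abs_descFactorial_sub_le hx _).trans ?_
  obtain ⟨e, he⟩ := Nat.exists_eq_add_of_le h2
  have hx' : (0 : ℝ) < d i := by positivity
  have hle' : (deg k i : ℝ) ≤ (2 * ∑ s, k s : ℕ) := by exact_mod_cast hle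
  have e1 : deg k i - 2 = e + 1 := by lia
  have e2 : (d i : ℝ) ^ deg k i = d i * ((d i : ℝ) ^ 2 * (d i : ℝ) ^ e) := by
    rw [he]
    ring
  rw [e1, e2]
  calc (deg k i : ℝ) * (deg k i / d i) * (d i * ((d i : ℝ) ^ 2 * (d i : ℝ) ^ e))
      = (deg k i : ℝ) ^ 2 * ((d i : ℝ) ^ 2 * (d i : ℝ) ^ e) := by field_simp
    _ ≤ ((2 * ∑ s, k s : ℕ) : ℝ) ^ 2 * ((d i : ℝ) ^ 2 * Δ ^ e) := by
      gcongr
      exact hd i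
    _ = _ := by
      rw [pow_succ Δ e]
      field_simp

include hk hN hC hΔ hd hΔC in
lemma abs_prod_descFactorial_sub_le :
    |∏ i, ((d i).descFactorial (deg k i) : ℝ) - ∏ i, geomMean (d i) ^ deg k i| ≤
      4 * (∑ s, k s : ℕ) ^ 3 * C ^ (∑ s, k s) * (Δ / total d) * weight d k *
        (total d : ℝ) ^ ∑ s, k s := by
  have hN' : (0 : ℝ) < total d := by exact_mod_cast hN
  have hΔ0 : 0 < Δ := by linarith
  have hw := weight_nonneg d k
  have hsum := sum_deg_sub_two hk
  rw [prod_eq_prod_support k (fun i D => ((d i).descFactorial D : ℝ)) (by simp),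
    prod_eq_prod_support k (fun i D => geomMean (d i) ^ D) (by simp)]
  have hcard : (support k).card ≤ ∑ s, k s := by lia
  -- With as many vertices as edges all degrees are two and nothing is lost. Otherwise a factor `Δ ^
  -- 2 / N` is available to be multiplied by the gain `1 / Δ`.
  rcases hcard.eq_or_lt with hv | hv
  · have hdeg : ∀ i ∈ support k, deg k i = 2 := by
      intro i hi
      have h1 : ∑ i ∈ support k, (deg k i - 2) = 0 := by lia
      have h2 := Finset.sum_eq_zero_iff.1 h1 i hi
      have h3 := two_le_deg hk hi
      lia
    rw [Finset.prod_congr rfl (g := fun i => geomMean (d i) ^ deg k i), sub_self, abs_zero]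
    · positivity
    · intro i hi
      rw [hdeg i hi, geomMean_pow_two]
  have h := abs_prod_sub_prod_le (support k)
    (a := fun i => ((d i).descFactorial (deg k i) : ℝ)) (b := fun i => geomMean (d i) ^ deg k i)
    (M := fun i => (d i : ℝ) ^ 2 * Δ ^ (deg k i - 2)) (fun _ _ => Nat.cast_nonneg _)
    (fun i _ => pow_nonneg (geomMean_nonneg _) _)
    (fun i hi => (descFactorial_le _ _).trans (pow_deg_le hk hd hi))
    (fun i hi => (pow_le_pow_left₀ (geomMean_nonneg _) (geomMean_le _) _).trans
      (pow_deg_le hk hd hi))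
    (fun i hi => abs_descFactorial_sub_geomMean_le hk hΔ hd hi)
  refine h.trans ?_
  rw [prod_sq_mul_pow hk hN]
  obtain ⟨e, he⟩ := Nat.exists_eq_add_of_lt hv
  have e1 : ∑ s, k s - (support k).card = e + 1 := by lia
  have hpow : (Δ ^ 2 / total d) ^ e ≤ C ^ ∑ s, k s :=
    (pow_le_pow_left₀ (by positivity) ((div_le_iff₀ hN').2 hΔC) _).trans
      (pow_le_pow_right₀ hC (by lia))
  have hc : ((support k).card : ℝ) ≤ (∑ s, k s : ℕ) := by exact_mod_cast hcard
  rw [e1]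
  calc _ = ((support k).card : ℝ) * (4 * (∑ s, k s : ℕ) ^ 2) * (Δ ^ 2 / total d) ^ e *
        (Δ / total d) * weight d k * (total d : ℝ) ^ ∑ s, k s := by
        push_cast
        rw [pow_succ _ e]
        field_simp
        ring
    _ ≤ ((∑ s, k s : ℕ) : ℝ) * (4 * (∑ s, k s : ℕ) ^ 2) * C ^ (∑ s, k s) *
        (Δ / total d) * weight d k * (total d : ℝ) ^ ∑ s, k s := by gcongr
    _ = _ := by ring

lemma one_le_prod_sym_pow (k : Site n → ℕ) : 1 ≤ ∏ s, sym s ^ k s := by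
  refine Finset.prod_induction _ (1 ≤ ·) (fun _ _ => one_le_mul_of_one_le_of_one_le) le_rfl
    fun s _ => one_le_pow₀ ?_
  rcases s with i | p <;> norm_num [sym]

lemma abs_configuration_sub_le (k : Site n → ℕ) (hN : 0 < total d) (heven : Even (total d)) :
    |(∑ σ : Pairing d, fallingProd k σ.counts) / Fintype.card (Pairing d) * (∏ s, sym s ^ k s) -
        (∏ i, ((d i).descFactorial (deg k i) : ℝ)) / (total d : ℝ) ^ ∑ s, k s| ≤
      2 * (∑ s, k s : ℕ) ^ 2 * (2 * (∑ s, k s : ℕ)) ^ (∑ s, k s) / total d *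
        ((∏ i, ((d i).descFactorial (deg k i) : ℝ)) / (total d : ℝ) ^ ∑ s, k s) := by
  have h := sum_fallingProd_counts d k
  have hcard : (Fintype.card (Pairing d) : ℝ) ≠ 0 := by
    exact_mod_cast (card_pairing_pos heven).ne'
  have hA : 0 ≤ ∏ i, ((d i).descFactorial (deg k i) : ℝ) :=
    Finset.prod_nonneg fun _ _ => Nat.cast_nonneg _
  rcases le_or_gt (2 * ∑ s, k s) (total d) with ht | ht
  · have hP := prod_odd_pos ht
    have hE : (∑ σ : Pairing d, fallingProd k σ.counts) / Fintype.card (Pairing d) *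
        (∏ s, sym s ^ k s) = (∏ i, ((d i).descFactorial (deg k i) : ℝ)) *
          (∏ r ∈ Finset.range (∑ s, k s), ((total d : ℝ) - 1 - 2 * r))⁻¹ := by
      rw [div_mul_eq_mul_div, ← div_eq_mul_inv, div_eq_div_iff hcard hP.ne', h]
    rw [hE, div_eq_mul_inv (∏ i, _ : ℝ), ← mul_sub, abs_mul, abs_of_nonneg hA,
      mul_left_comm]
    exact mul_le_mul_of_nonneg_left (abs_inv_prod_odd_sub_le hN ht) hA
  -- The degrees of `k` sum to more than `N`, so some vertex has too few half-edges and both moments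
  -- in the comparison vanish.
  · obtain ⟨i, hi⟩ : ∃ i, d i < deg k i := by
      by_contra! hle
      have := Finset.sum_le_sum fun i (_ : i ∈ Finset.univ) => hle i
      rw [sum_deg] at this
      exact absurd ht (not_lt.2 this)
    have h0 : ∏ i, ((d i).descFactorial (deg k i) : ℝ) = 0 :=
      Finset.prod_eq_zero (Finset.mem_univ i) (by simp [Nat.descFactorial_of_lt hi])
    -- Negative factors are possible here, but `N` is even, so every factor is odd.
    have hP : ∏ r ∈ Finset.range (∑ s, k s), ((total d : ℝ) - 1 - 2 * r) ≠ 0 := by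
      refine Finset.prod_ne_zero_iff.2 fun r _ hr => ?_
      obtain ⟨M, hM⟩ := heven
      rw [hM] at hr
      have : ((M + M : ℕ) : ℤ) - 1 - 2 * (r : ℤ) = 0 := by exact_mod_cast hr
      lia
    rw [h0, zero_mul] at h
    have hE := (mul_eq_zero.1 h).resolve_right hP
    rw [h0, div_mul_eq_mul_div, hE]
    simp

include hk hN hC hΔ hd hΔC in
/-- Comparison of the joint factorial moments of the configuration model and of the independent
Poisson variables. -/
lemma abs_fallingProd_moment_sub_le (heven : Even (total d)) :
    |(∑ σ : Pairing d, fallingProd k σ.counts) / Fintype.card (Pairing d) -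
        ∫ x, fallingProd k x ∂(poissonLaw d)| ≤
      factorialConst C (∑ s, k s) * (Δ / total d) * weight d k := by
  have hN' : (0 : ℝ) < total d := by exact_mod_cast hN
  have hw := weight_nonneg d k
  rw [integral_fallingProd]
  have h1 := abs_configuration_sub_le (d := d) k hN heven
  have h2 := abs_prod_descFactorial_sub_le hk hN hC hΔ hd hΔC
  have h3 := prod_descFactorial_le hk hN hC hΔ hd hΔC
  have h4 := prod_rate_pow d k
  have hS := one_le_prod_sym_pow k
  set t := ∑ s, k s
  set E := (∑ σ : Pairing d, fallingProd k σ.counts) / Fintype.card (Pairing d)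
  set R := ∏ s, (rate d s : ℝ) ^ k s
  set S := ∏ s, sym s ^ k s
  set A := ∏ i, ((d i).descFactorial (deg k i) : ℝ)
  set B := ∏ i, geomMean (d i) ^ deg k i
  have hNt : (0 : ℝ) < (total d : ℝ) ^ t := by positivity
  have h3' : A / (total d : ℝ) ^ t ≤ weight d k * C ^ t := (div_le_iff₀ hNt).2 h3
  have h2' : |A / (total d : ℝ) ^ t - B / (total d : ℝ) ^ t| ≤
      4 * (t : ℝ) ^ 3 * C ^ t * (Δ / total d) * weight d k := by
    rw [← sub_div, abs_div, abs_of_pos hNt]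
    exact (div_le_iff₀ hNt).2 h2
  -- The explicit formulas are for `E * S` and `R * S`; `S ≥ 1` can be inserted at no cost.
  calc |E - R| ≤ |E - R| * S := le_mul_of_one_le_right (abs_nonneg _) hS
    _ = |(E * S - A / (total d : ℝ) ^ t) +
        (A / (total d : ℝ) ^ t - B / (total d : ℝ) ^ t)| := by
      rw [← h4, sub_add_sub_cancel, ← sub_mul, abs_mul, abs_of_nonneg (by linarith : 0 ≤ S)]
    _ ≤ 2 * (t : ℝ) ^ 2 * (2 * t) ^ t / total d * (weight d k * C ^ t) +
        4 * (t : ℝ) ^ 3 * C ^ t * (Δ / total d) * weight d k := by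
      refine (abs_add_le _ _).trans (add_le_add (h1.trans ?_) h2')
      gcongr
    _ ≤ 2 * (t : ℝ) ^ 2 * (2 * t) ^ t * (Δ / total d) * (weight d k * C ^ t) +
        4 * (t : ℝ) ^ 3 * C ^ t * (Δ / total d) * weight d k := by
      rw [div_eq_mul_one_div (2 * (t : ℝ) ^ 2 * (2 * t) ^ t)]
      gcongr
    _ = _ := by
      rw [factorialConst]
      ring

end Bounds

/-! ### From factorial moments to moments of `Z` -/

lemma fallingProd_mul (k x : Site n → ℕ) (s : Site n) :
    fallingProd k x * x s = fallingProd (k + Pi.single s 1) x + k s * fallingProd k x := by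
  have h := prod_stepFactorial_add_single_right (fun _ => 1) (fun s => (x s : ℝ)) k s
  unfold fallingProd
  rw [h]
  ring

/-- Of two edges chosen at `s`, none, one or both may be among the `k s` edges already chosen; these
cases give the three terms. -/
lemma fallingProd_mul_choose (k x : Site n → ℕ) (s : Site n) :
    fallingProd k x * (x s).choose 2 =
      1 / 2 * fallingProd (k + Pi.single s 1 + Pi.single s 1) x +
        k s * fallingProd (k + Pi.single s 1) x + (k s).choose 2 * fallingProd k x := by
  have h1 := fallingProd_mul k x s
  have h2 := fallingProd_mul (k + Pi.single s 1) x s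
  simp only [Pi.add_apply, Pi.single_eq_same, Nat.cast_add, Nat.cast_one] at h2
  rw [Nat.cast_choose_two, Nat.cast_choose_two]
  linear_combination (1 / 2 * ((x s : ℝ) - 1) + k s / 2) * h1 + 1 / 2 * h2

lemma fallingProd_mul_pow_succ (k x : Site n → ℕ) (m : ℕ) :
    fallingProd k x * (loopsAndParallel x : ℝ) ^ (m + 1) =
      ∑ i, (fallingProd (k + Pi.single (Sum.inl i) 1) x * (loopsAndParallel x : ℝ) ^ m +
        k (Sum.inl i) * (fallingProd k x * (loopsAndParallel x : ℝ) ^ m)) +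
      ∑ p, (1 / 2 * (fallingProd (k + Pi.single (Sum.inr p) 1 + Pi.single (Sum.inr p) 1) x *
          (loopsAndParallel x : ℝ) ^ m) +
        k (Sum.inr p) * (fallingProd (k + Pi.single (Sum.inr p) 1) x *
          (loopsAndParallel x : ℝ) ^ m) +
        (k (Sum.inr p)).choose 2 * (fallingProd k x * (loopsAndParallel x : ℝ) ^ m)) := by
  have e : fallingProd k x * (loopsAndParallel x : ℝ) ^ (m + 1) =
      (∑ i, fallingProd k x * x (Sum.inl i) +
        ∑ p, fallingProd k x * (x (Sum.inr p)).choose 2) * (loopsAndParallel x : ℝ) ^ m := by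
    rw [← Finset.mul_sum, ← Finset.mul_sum, ← mul_add, pow_succ']
    nth_rewrite 1 [loopsAndParallel]
    push_cast
    ring
  rw [e, add_mul, Finset.sum_mul, Finset.sum_mul]
  congr 1
  · refine Finset.sum_congr rfl fun i _ => ?_
    rw [fallingProd_mul]
    ring
  · refine Finset.sum_congr rfl fun p _ => ?_
    rw [fallingProd_mul_choose]
    ring

/-- The moment `E (x)_k Z ^ m` under the law `μ` of the counts. -/
noncomputable def mixedMoment (μ : Measure (Site n → ℕ)) (k : Site n → ℕ) (m : ℕ) : ℝ :=
  ∫ x, fallingProd k x * (loopsAndParallel x : ℝ) ^ m ∂μ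

lemma integrable_fallingProd_mul_pow {μ : Measure (Site n → ℕ)}
    (h : ∀ k, Integrable (fallingProd k) μ) (m : ℕ) :
    ∀ k, Integrable (fun x => fallingProd k x * (loopsAndParallel x : ℝ) ^ m) μ := by
  induction m with
  | zero => simpa using h
  | succ m ih =>
    intro k
    simp only [fallingProd_mul_pow_succ]
    refine Integrable.add ?_ ?_
    · exact integrable_finsetSum _ fun i _ => (ih _).add ((ih _).const_mul _)
    · exact integrable_finsetSum _ fun p _ =>
        (((ih _).const_mul _).add ((ih _).const_mul _)).add ((ih _).const_mul _)

lemma mixedMoment_succ {μ : Measure (Site n → ℕ)} (h : ∀ k, Integrable (fallingProd k) μ)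
    (k : Site n → ℕ) (m : ℕ) :
    mixedMoment μ k (m + 1) =
      ∑ i, (mixedMoment μ (k + Pi.single (Sum.inl i) 1) m +
        k (Sum.inl i) * mixedMoment μ k m) +
      ∑ p, (1 / 2 * mixedMoment μ (k + Pi.single (Sum.inr p) 1 + Pi.single (Sum.inr p) 1) m +
        k (Sum.inr p) * mixedMoment μ (k + Pi.single (Sum.inr p) 1) m +
        (k (Sum.inr p)).choose 2 * mixedMoment μ k m) := by
  have ih := integrable_fallingProd_mul_pow h m
  have h1 : ∀ i, Integrable (fun x =>
      fallingProd (k + Pi.single (Sum.inl i) 1) x * (loopsAndParallel x : ℝ) ^ m +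
        k (Sum.inl i) * (fallingProd k x * (loopsAndParallel x : ℝ) ^ m)) μ :=
    fun i => (ih _).add ((ih _).const_mul _)
  have h2 : ∀ p, Integrable (fun x =>
      1 / 2 * (fallingProd (k + Pi.single (Sum.inr p) 1 + Pi.single (Sum.inr p) 1) x *
          (loopsAndParallel x : ℝ) ^ m) +
        k (Sum.inr p) * (fallingProd (k + Pi.single (Sum.inr p) 1) x *
          (loopsAndParallel x : ℝ) ^ m)) μ :=
    fun p => ((ih _).const_mul _).add ((ih _).const_mul _)
  have h3 : ∀ p, Integrable (fun x => ((k (Sum.inr p)).choose 2 : ℝ) *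
      (fallingProd k x * (loopsAndParallel x : ℝ) ^ m)) μ := fun p => (ih _).const_mul _
  have h4 := fun p => (h2 p).fun_add (h3 p)
  unfold mixedMoment
  simp only [fallingProd_mul_pow_succ]
  rw [integral_add (integrable_finsetSum _ fun i _ => h1 i)
      (integrable_finsetSum _ fun p _ => h4 p),
    integral_finsetSum _ fun i _ => h1 i, integral_finsetSum _ fun p _ => h4 p]
  congr 1
  · refine Finset.sum_congr rfl fun i _ => ?_
    rw [integral_add (ih _) ((ih _).const_mul _), integral_const_mul]
  · refine Finset.sum_congr rfl fun p _ => ?_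
    rw [integral_add (h2 p) (h3 p), integral_add ((ih _).const_mul _) ((ih _).const_mul _),
      integral_const_mul, integral_const_mul, integral_const_mul]

/-- The counting measure on pairings, pushed forward to the counts. -/
noncomputable def countsMeasure (d : Fin n → ℕ) : Measure (Site n → ℕ) :=
  ∑ σ : Pairing d, Measure.dirac σ.counts

/-- As a measure, the sum over pairings obeys the same integral recursion `mixedMoment_succ` as the
Poisson law. -/
lemma integrable_countsMeasure (f : (Site n → ℕ) → ℝ) : Integrable f (countsMeasure d) := by
  rw [countsMeasure, integrable_finsetSum_measure]
  exact fun σ _ => integrable_dirac (by simp)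

lemma integral_countsMeasure (f : (Site n → ℕ) → ℝ) :
    ∫ x, f x ∂(countsMeasure d) = ∑ σ : Pairing d, f σ.counts := by
  rw [countsMeasure, integral_finsetSum_measure fun σ _ => integrable_dirac (by simp)]
  simp

/-- The difference of the moments `E (x)_k Z ^ m` of the two models. -/
noncomputable def momentDiff (d : Fin n → ℕ) (k : Site n → ℕ) (m : ℕ) : ℝ :=
  mixedMoment (countsMeasure d) k m / Fintype.card (Pairing d) - mixedMoment (poissonLaw d) k m

lemma momentDiff_succ (d : Fin n → ℕ) (k : Site n → ℕ) (m : ℕ) :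
    momentDiff d k (m + 1) =
      ∑ i, (momentDiff d (k + Pi.single (Sum.inl i) 1) m + k (Sum.inl i) * momentDiff d k m) +
      ∑ p, (1 / 2 * momentDiff d (k + Pi.single (Sum.inr p) 1 + Pi.single (Sum.inr p) 1) m +
        k (Sum.inr p) * momentDiff d (k + Pi.single (Sum.inr p) 1) m +
        (k (Sum.inr p)).choose 2 * momentDiff d k m) := by
  unfold momentDiff
  rw [mixedMoment_succ (fun _ => integrable_countsMeasure _),
    mixedMoment_succ (integrable_fallingProd d), add_div, Finset.sum_div, Finset.sum_div,
    add_sub_add_comm, ← Finset.sum_sub_distrib, ← Finset.sum_sub_distrib]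
  congr 1 <;> exact Finset.sum_congr rfl fun _ _ => by ring

/-! ### Growth of the weight along the recursion -/

/-- The factor by which `weight d k` changes when an edge at `i` is added to `k`. -/
noncomputable def newFactor (d : Fin n → ℕ) (k : Site n → ℕ) (i : Fin n) : ℝ :=
  if deg k i = 0 then (d i : ℝ) ^ 2 / total d else 1

lemma newFactor_nonneg (d : Fin n → ℕ) (k : Site n → ℕ) (i : Fin n) : 0 ≤ newFactor d k i := by
  unfold newFactor
  split_ifs <;> positivity

lemma weight_eq_mul_prod {k l : Site n → ℕ} (S : Finset (Fin n))
    (h : ∀ i, deg l i = 0 ↔ deg k i = 0 ∧ i ∉ S) :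
    weight d l = weight d k * ∏ i ∈ S, newFactor d k i := by
  have hS : ∏ i ∈ S, newFactor d k i = ∏ i, if i ∈ S then newFactor d k i else 1 := by
    simp
  rw [hS, weight, weight, ← Finset.prod_mul_distrib]
  refine Finset.prod_congr rfl fun i _ => ?_
  simp only [h i, newFactor]
  by_cases h1 : deg k i = 0 <;> by_cases h2 : i ∈ S <;> simp [h1, h2]

lemma weight_add_loop (k : Site n → ℕ) (i : Fin n) :
    weight d (k + Pi.single (Sum.inl i) 1) = weight d k * newFactor d k i := by
  rw [weight_eq_mul_prod (k := k) {i}, Finset.prod_singleton]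
  intro j
  rw [deg_add_single]
  by_cases h : j = i <;> simp [ends, h]

lemma weight_add_two_edges (k : Site n → ℕ) (p : {p : Fin n × Fin n // p.1 < p.2}) :
    weight d (k + Pi.single (Sum.inr p) 1 + Pi.single (Sum.inr p) 1) =
      weight d k * (newFactor d k p.1.1 * newFactor d k p.1.2) := by
  rw [weight_eq_mul_prod (k := k) {p.1.1, p.1.2}, Finset.prod_pair p.2.ne]
  intro j
  rw [deg_add_single, deg_add_single]
  by_cases h1 : j = p.1.1 <;> by_cases h2 : j = p.1.2 <;> simp [ends, h1, h2]

lemma deg_pos_of_ne_zero {k : Site n → ℕ} {s : Site n} (h : k s ≠ 0) :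
    deg k (ends s).1 ≠ 0 ∧ deg k (ends s).2 ≠ 0 := by
  constructor <;> refine fun h0 => h ?_ <;>
    simpa using (Finset.sum_eq_zero_iff.1 h0) s (Finset.mem_univ s)

/-- A further edge parallel to a present one leaves the set of non-isolated vertices as it is. -/
lemma weight_add_edge {k : Site n → ℕ} {p : {p : Fin n × Fin n // p.1 < p.2}}
    (hp : k (Sum.inr p) ≠ 0) : weight d (k + Pi.single (Sum.inr p) 1) = weight d k := by
  rw [weight_eq_mul_prod (k := k) ∅, Finset.prod_empty, mul_one]
  intro j
  obtain ⟨h1, h2⟩ := deg_pos_of_ne_zero hp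
  simp only [ends, Sum.elim_inr] at h1 h2
  rw [deg_add_single]
  by_cases e1 : j = p.1.1 <;> by_cases e2 : j = p.1.2 <;> simp_all [ends]

/-- At most `2 t` vertices are non-isolated and contribute one each; the others contribute at most
`∑ d i ^ 2 / N ≤ C`. -/
lemma sum_newFactor_le {C : ℝ} (hN : 0 < total d)
    (hC : ∑ i, (d i : ℝ) ^ 2 ≤ C * (total d : ℝ)) (k : Site n → ℕ) :
    ∑ i, newFactor d k i ≤ 2 * (∑ s, k s : ℕ) + C := by
  have hN' : (0 : ℝ) < total d := by exact_mod_cast hN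
  have h1 : ∑ i, (deg k i : ℝ) = 2 * (∑ s, k s : ℕ) := by exact_mod_cast sum_deg k
  have h2 : ∑ i, (d i : ℝ) ^ 2 / total d ≤ C := by
    rw [← Finset.sum_div]
    exact (div_le_iff₀ hN').2 hC
  refine le_trans ?_ (add_le_add h1.le h2)
  rw [← Finset.sum_add_distrib]
  refine Finset.sum_le_sum fun i _ => ?_
  unfold newFactor
  split_ifs with h
  · simp [h]
  · have : (1 : ℝ) ≤ deg k i := by exact_mod_cast Nat.one_le_iff_ne_zero.2 h
    have : 0 ≤ (d i : ℝ) ^ 2 / total d := by positivity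
    linarith

lemma sum_newFactor_mul_le (k : Site n → ℕ) :
    ∑ p : {p : Fin n × Fin n // p.1 < p.2}, newFactor d k p.1.1 * newFactor d k p.1.2 ≤
      (∑ i, newFactor d k i) ^ 2 := by
  rw [sq, Finset.sum_mul_sum, ← Finset.sum_product', Finset.univ_product_univ,
    ← Finset.sum_subtype (Finset.univ.filter fun p : Fin n × Fin n => p.1 < p.2) (by simp)
      fun p => newFactor d k p.1 * newFactor d k p.2]
  exact Finset.sum_le_sum_of_subset_of_nonneg (Finset.subset_univ _) fun p _ _ =>
    mul_nonneg (newFactor_nonneg d k _) (newFactor_nonneg d k _)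

/-! ### Induction on the exponent and conclusion -/

/-- The constant in the comparison of the moments `E (x)_k Z ^ m` for `∑ s, k s ≤ T`. -/
noncomputable def momentConst (C : ℝ) : ℕ → ℕ → ℝ
  | 0, T => ∑ t ∈ Finset.range (T + 1), factorialConst C t
  | m + 1, T => momentConst C m (T + 2) * (2 * T + C + (2 * T + C) ^ 2 + T + T ^ 2)

lemma momentConst_nonneg {C : ℝ} (hC : 0 ≤ C) (m : ℕ) : ∀ T, 0 ≤ momentConst C m T := by
  induction m with
  | zero =>
    intro T
    refine Finset.sum_nonneg fun t _ => ?_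
    unfold factorialConst
    positivity
  | succ m ih =>
    intro T
    have := ih (T + 2)
    unfold momentConst
    positivity

/-- Induction on `m` through `momentDiff_succ`. The factor `weight d k` in the bound makes the sums
over new vertices bounded independently of `n`. -/
lemma abs_momentDiff_le {C Δ : ℝ} (hN : 0 < total d) (heven : Even (total d)) (hC : 1 ≤ C)
    (hΔ : 1 ≤ Δ) (hd : ∀ i, (d i : ℝ) ≤ Δ) (hΔC : Δ ^ 2 ≤ C * total d)
    (hdC : ∑ i, (d i : ℝ) ^ 2 ≤ C * (total d : ℝ)) (m : ℕ) :
    ∀ (T : ℕ) (k : Site n → ℕ), ∑ s, k s ≤ T → (∀ i, deg k i ≠ 1) →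
      |momentDiff d k m| ≤ momentConst C m T * (Δ / total d) * weight d k := by
  have hN' : (0 : ℝ) < total d := by exact_mod_cast hN
  have hC0 : 0 ≤ C := by linarith
  have hΔ0 : 0 < Δ := by linarith
  induction m with
  | zero =>
    intro T k hT hk
    have h := abs_fallingProd_moment_sub_le hk hN hC hΔ hd hΔC heven
    have hle : factorialConst C (∑ s, k s) ≤ momentConst C 0 T :=
      Finset.single_le_sum (f := factorialConst C) (fun t _ => by
        unfold factorialConst
        positivity) (Finset.mem_range.2 (Nat.lt_succ_of_le hT))
    have hw := weight_nonneg d k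
    simp only [momentDiff, mixedMoment, pow_zero, mul_one, integral_countsMeasure]
    exact h.trans (by gcongr)
  | succ m ih =>
    intro T k hT hk
    have hw := weight_nonneg d k
    have hsum : ∀ s : Site n, ∑ s', (k + Pi.single s 1 : Site n → ℕ) s' = ∑ s', k s' + 1 := by
      intro s
      simp [Finset.sum_add_distrib]
    have hsum2 : ∀ s : Site n, ∑ s', (k + Pi.single s 1 + Pi.single s 1 : Site n → ℕ) s' =
        ∑ s', k s' + 2 := by
      intro s
      simp [Finset.sum_add_distrib]
    have hf := newFactor_nonneg d k
    have hconst := momentConst_nonneg hC0 m (T + 2)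
    -- One recursion step adds at most two edges, so `T + 2` serves for all its terms.
    set Q := momentConst C m (T + 2) * (Δ / total d) * weight d k with hQ
    have hQ0 : 0 ≤ Q := by positivity
    have b0 : |momentDiff d k m| ≤ Q := ih (T + 2) k (by lia) hk
    have b1 : ∀ i, |momentDiff d (k + Pi.single (Sum.inl i) 1) m| ≤ Q * newFactor d k i := by
      intro i
      have h := ih (T + 2) (k + Pi.single (Sum.inl i) 1) (by rw [hsum]; lia) (by
        intro j
        have := hk j
        rw [deg_add_single]
        by_cases e : j = i
        · simp [ends, e]
        · simpa [ends, e] using this)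
      rwa [weight_add_loop, ← mul_assoc, ← hQ] at h
    have b2 : ∀ p, |momentDiff d (k + Pi.single (Sum.inr p) 1 + Pi.single (Sum.inr p) 1) m| ≤
        Q * (newFactor d k p.1.1 * newFactor d k p.1.2) := by
      intro p
      have h := ih (T + 2) (k + Pi.single (Sum.inr p) 1 + Pi.single (Sum.inr p) 1)
        (by rw [hsum2]; lia) (by
          intro j
          have := hk j
          rw [deg_add_single, deg_add_single]
          simp only [Pi.add_apply, Pi.single_apply]
          split_ifs <;> lia)
      rwa [weight_add_two_edges, ← mul_assoc, ← hQ] at h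
    -- A single new edge could create degree one, but its coefficient `k (Sum.inr p)` vanishes
    -- unless both ends already have degree at least two.
    have b3 : ∀ p, k (Sum.inr p) * |momentDiff d (k + Pi.single (Sum.inr p) 1) m| ≤
        k (Sum.inr p) * Q := by
      intro p
      by_cases hp : k (Sum.inr p) = 0
      · simp [hp]
      have h := ih (T + 2) (k + Pi.single (Sum.inr p) 1) (by rw [hsum]; lia) (by
        intro j
        have h0 := hk j
        obtain ⟨h1, h2⟩ := deg_pos_of_ne_zero hp
        rw [deg_add_single]
        simp only [Pi.add_apply, Pi.single_apply]
        split_ifs with e1 e2 e2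
        · lia
        · rw [← e1] at h1
          lia
        · rw [← e2] at h2
          lia
        · lia)
      rw [weight_add_edge hp] at h
      gcongr
    have hkT : ∑ i, (k (Sum.inl i) : ℝ) + ∑ p, (k (Sum.inr p) : ℝ) ≤ T := by
      rw [Fintype.sum_sum_type] at hT
      exact_mod_cast hT
    have hkp : ∑ p, (k (Sum.inr p) : ℝ) ≤ T :=
      (le_add_of_nonneg_left (Finset.sum_nonneg fun _ _ => Nat.cast_nonneg _)).trans hkT
    have hchoose : ∀ p, ((k (Sum.inr p)).choose 2 : ℝ) ≤ T * k (Sum.inr p) := by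
      intro p
      have h1 : k (Sum.inr p) ≤ T :=
        (Finset.single_le_sum (f := k) (fun _ _ => Nat.zero_le _) (Finset.mem_univ _)).trans hT
      have h2 : (k (Sum.inr p)).choose 2 ≤ T * k (Sum.inr p) := by
        rw [Nat.choose_two_right]
        refine (Nat.div_le_self _ _).trans ?_
        rw [mul_comm]
        exact Nat.mul_le_mul_right _ ((Nat.sub_le _ _).trans h1)
      exact_mod_cast h2
    have hF : ∑ i, newFactor d k i ≤ 2 * T + C := by
      refine (sum_newFactor_le hN hdC k).trans ?_
      have : ((∑ s, k s : ℕ) : ℝ) ≤ T := by exact_mod_cast hT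
      linarith
    have hFF : ∑ p : {p : Fin n × Fin n // p.1 < p.2}, newFactor d k p.1.1 * newFactor d k p.1.2 ≤
        (2 * T + C) ^ 2 :=
      (sum_newFactor_mul_le k).trans
        (pow_le_pow_left₀ (Finset.sum_nonneg fun i _ => hf i) hF 2)
    have hL : ∀ i, |momentDiff d (k + Pi.single (Sum.inl i) 1) m +
        k (Sum.inl i) * momentDiff d k m| ≤ Q * newFactor d k i + Q * k (Sum.inl i) := by
      intro i
      refine (abs_add_le _ _).trans (add_le_add (b1 i) ?_)
      rw [abs_mul, Nat.abs_cast, mul_comm]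
      gcongr
    have hE : ∀ p, |1 / 2 * momentDiff d (k + Pi.single (Sum.inr p) 1 + Pi.single (Sum.inr p) 1) m +
        k (Sum.inr p) * momentDiff d (k + Pi.single (Sum.inr p) 1) m +
        (k (Sum.inr p)).choose 2 * momentDiff d k m| ≤
        Q * (newFactor d k p.1.1 * newFactor d k p.1.2) + Q * k (Sum.inr p) +
          Q * T * k (Sum.inr p) := by
      intro p
      refine (abs_add_le _ _).trans (add_le_add ((abs_add_le _ _).trans (add_le_add ?_ ?_)) ?_)
      · rw [abs_mul, abs_of_pos (by norm_num : (0 : ℝ) < 1 / 2)]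
        linarith [b2 p, abs_nonneg
          (momentDiff d (k + Pi.single (Sum.inr p) 1 + Pi.single (Sum.inr p) 1) m)]
      · rw [abs_mul, Nat.abs_cast, mul_comm Q]
        exact b3 p
      · rw [abs_mul, Nat.abs_cast, mul_assoc, mul_comm Q]
        exact mul_le_mul (hchoose p) b0 (abs_nonneg _) (by positivity)
    rw [momentDiff_succ]
    calc _ ≤ ∑ i, (Q * newFactor d k i + Q * k (Sum.inl i)) +
          ∑ p : {p : Fin n × Fin n // p.1 < p.2},
            (Q * (newFactor d k p.1.1 * newFactor d k p.1.2) + Q * k (Sum.inr p) +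
              Q * T * k (Sum.inr p)) :=
          (abs_add_le _ _).trans (add_le_add
            ((Finset.abs_sum_le_sum_abs _ _).trans (Finset.sum_le_sum fun i _ => hL i))
            ((Finset.abs_sum_le_sum_abs _ _).trans (Finset.sum_le_sum fun p _ => hE p)))
      _ = Q * (∑ i, newFactor d k i + ∑ p : {p : Fin n × Fin n // p.1 < p.2},
            newFactor d k p.1.1 * newFactor d k p.1.2 +
          (∑ i, (k (Sum.inl i) : ℝ) + ∑ p, (k (Sum.inr p) : ℝ)) +
            T * ∑ p, (k (Sum.inr p) : ℝ)) := by
        simp only [Finset.sum_add_distrib, ← Finset.mul_sum]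
        ring
      -- In order: new loops, new pairs of parallel edges, coincidences with one chosen edge,
      -- coincidences with two.
      _ ≤ Q * (2 * T + C + (2 * T + C) ^ 2 + T + T * T) := by gcongr
      _ = momentConst C (m + 1) T * (Δ / total d) * weight d k := by
        rw [hQ, momentConst]
        ring

end ConfigModel

theorem lemma1p3 (C : ℝ) (m : ℕ) (hm : 1 ≤ m) :
    ∃ C' : ℝ, ∀ (n : ℕ) (d : Fin n → ℕ),
      Even (ConfigModel.total d) → 0 < ConfigModel.total d →
      (∑ i, (d i : ℝ) ^ 2) ≤ C * (ConfigModel.total d : ℝ) →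
        Integrable (fun x => (ConfigModel.loopsAndParallel x : ℝ) ^ m)
          (ConfigModel.poissonLaw d) ∧
        |ConfigModel.momentZ d m
            - ∫ x, (ConfigModel.loopsAndParallel x : ℝ) ^ m ∂(ConfigModel.poissonLaw d)|
          ≤ C' * (ConfigModel.total d : ℝ) ^ (-(1 / 2) : ℝ) ∧
        |ConfigModel.momentZ d m
            - ∫ x, (ConfigModel.loopsAndParallel x : ℝ) ^ m ∂(ConfigModel.poissonLaw d)|
          ≤ C' * (((Finset.univ.sup d : ℕ) : ℝ) / (ConfigModel.total d : ℝ)) := by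
  open ConfigModel in
  -- The factor `1` serves the bound by `max d i / N`, the factor `√C` the bound by `N^(-1/2)`.
  refine ⟨momentConst C m 0 * max 1 √C, fun n d heven hN hdC => ?_⟩
  have hN' : (0 : ℝ) < total d := by exact_mod_cast hN
  have hsq : (total d : ℝ) ≤ ∑ i, (d i : ℝ) ^ 2 := by
    rw [total]
    exact_mod_cast Finset.sum_le_sum fun i _ => Nat.le_self_pow two_ne_zero (d i)
  -- Integers satisfy `d i ≤ d i ^ 2`, so `N ≤ C N` with `N > 0`.
  have hC : 1 ≤ C := by
    by_contra! h
    nlinarith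
  have hC0 : 0 ≤ C := by linarith
  have hne : (Finset.univ : Finset (Fin n)).Nonempty := by
    by_contra h
    simp [total, Finset.not_nonempty_iff_eq_empty.1 h] at hN
  obtain ⟨j, -, hj⟩ := Finset.exists_mem_eq_sup Finset.univ hne d
  have hd : ∀ i, d i ≤ Finset.univ.sup d := fun i => Finset.le_sup (Finset.mem_univ i)
  have hΔ : (1 : ℝ) ≤ (Finset.univ.sup d : ℕ) := by
    rw [Nat.one_le_cast, Nat.one_le_iff_ne_zero]
    intro h0
    refine hN.ne' (Finset.sum_eq_zero fun i _ => ?_)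
    have := hd i
    lia
  have hΔC : ((Finset.univ.sup d : ℕ) : ℝ) ^ 2 ≤ C * total d := by
    rw [hj]
    exact (Finset.single_le_sum (f := fun i => (d i : ℝ) ^ 2) (fun _ _ => by positivity)
      (Finset.mem_univ j)).trans hdC
  -- For `k = 0` the mixed moments are the moments of `Z`, and the weight is the empty product.
  have h := abs_momentDiff_le hN heven hC hΔ (fun i => by exact_mod_cast hd i) hΔC hdC m 0 0
    (by simp) (by simp [deg])
  have hfp : ∀ x : Site n → ℕ, fallingProd 0 x = 1 := fun x => by simp [fallingProd]
  have hw : weight d 0 = 1 := by simp [weight, deg]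
  have hint := integrable_fallingProd_mul_pow (integrable_fallingProd d) m 0
  simp only [momentDiff, mixedMoment, integral_countsMeasure, hfp, one_mul, hw, mul_one] at h hint
  change |momentZ d m - _| ≤ _ at h
  have hK := momentConst_nonneg hC0 m 0
  refine ⟨hint, h.trans ?_, h.trans ?_⟩
  · have h1 : ((Finset.univ.sup d : ℕ) : ℝ) ≤ √C * √(total d) := by
      rw [← Real.sqrt_mul hC0]
      exact Real.le_sqrt_of_sq_le hΔC
    have h2 : ((Finset.univ.sup d : ℕ) : ℝ) / total d ≤ √C * (total d : ℝ) ^ (-(1 / 2) : ℝ) := by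
      rw [Real.rpow_neg hN'.le, ← Real.sqrt_eq_rpow, div_le_iff₀ hN', mul_assoc]
      refine h1.trans_eq ?_
      rw [inv_mul_eq_div, Real.div_sqrt]
    rw [mul_assoc]
    refine mul_le_mul_of_nonneg_left (h2.trans ?_) hK
    gcongr
    exact le_max_right _ _
  · gcongr
    exact le_mul_of_one_le_right hK (le_max_left _ _)
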